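/- Conventions. A varifold is a finite positive Borel measure $V$ on $\mathbb R^2\times\{1\text{-dimensional subspaces of }\mathbb R^2\}$ (subspaces being metrized by the distance of their orthogonal projections), and $\mu_V$ is its projection to $\mathbb R^2$. For a countably $1$-rectifiable, $\mathcal H^1$-measurable set $\Gamma\subset\mathbb R^2$ and $\theta:\Gamma\to\{1,2,\dots\}$ with $\int_\Gamma\theta\,d\mathcal H^1<\infty$, the integer rectifiable varifold $\mathbf v(\Gamma,\theta)$ is the image of $\theta\,\mathcal H^1\llcorner\Gamma$ under $x\mapsto(x,T_x\Gamma)$, where $T_x\Gamma$ is the approximate tangent line. A varifold $V$ has generalized curvature $k_V\in L^1_{loc}(\mu_V;\mathbb R^2)$ and generalized boundary $\sigma_V$, a finite $\mathbb R^2$-valued Borel measure singular with respect to $\mu_V$, if for all $X\in C^1_c(\mathbb R^2;\mathbb R^2)$ $$\int \operatorname{div}_L X(x)\,dV(x,L)=-\int\langle X,k_V\rangle\,d\mu_V+\int X\,d\sigma_V ,$$ where $\operatorname{div}_L X=\operatorname{tr}(\pi_L\circ DX)$ and $\pi_L$ is the orthogonal projection onto $L$. Put $\mathcal E_p(V)=\int|k_V|^p\,d\mu_V$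 if $V$ has generalized curvature, $\mathcal E_p(V)=+\infty$ otherwise, and $\mathcal F_p(V)=\mu_V(\mathbb R^2)+\mathcal E_p(V)$. Let $S^1=[0,2\pi]/(0\sim2\pi)$. A regular curve $\gamma\in W^{2,p}(S^1;\mathbb R^2)$ is one whose $C^1$ representative, again denoted $\gamma$, satisfies $\gamma'\neq0$ everywhere; its curvature vector is $k_\gamma=|\gamma'|^{-2}\big(\gamma''-\langle\gamma'',\tau\rangle\tau\big)$ with $\tau=\gamma'/|\gamma'|$ and $\gamma''$ the weak second derivative, and $\mathcal E_p(\gamma)=\int_0^{2\pi}|k_\gamma|^p|\gamma'|\,dt$. Its image varifold is $\gamma_\sharp(\mathbf v(S^1,1))=\mathbf v\big(\gamma(S^1),\,x\mapsto\sharp\gamma^{-1}(x)\big)$. Lemma. Let $1<p<\infty$, and let $V=\mathbf v(\Gamma,\theta_V)$ be an integer rectifiable varifold with $\mathcal F_p(V)<\infty$ and $$V=\sum_{i=1}^N(\gamma_i)_\sharp(\mathbf v(S^1,1))$$ for finitely many regular curves $\gamma_i\in W^{2,p}(S^1;\mathbb R^2)$. Then $V$ has the generalized curvature $$k_V(x)=\frac1{\theta_V(x)}\sum_{i=1}^N\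 \sum_{t\in\gamma_i^{-1}(x)}k_{\gamma_i}(t)\qquad\text{for }\mathcal H^1\text{-a.e. }x\in\Gamma$$ and the generalized boundary $\sigma_V=0$, and these are the only generalized curvature ($\mathcal H^1$-a.e. on $\Gamma$) and generalized boundary of $V$. Moreover $$\mathcal E_p(V)=\sum_{i=1}^N\mathcal E_p(\gamma_i).$$ In particular this value does not depend on the curves: if also $V=\sum_{j=1}^M(\eta_j)_\sharp(\mathbf v(S^1,1))$ with regular curves $\eta_j\in W^{2,p}(S^1;\mathbb R^2)$, then $\sum_{j=1}^M\mathcal E_p(\eta_j)=\sum_{i=1}^N\mathcal E_p(\gamma_i)$. -/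

import Mathlib

open Set Filter Topology MeasureTheory
open scoped ENNReal NNReal ContDiff

noncomputable section

namespace ElasticVarifold

/-- The Euclidean plane `ℝ²`. -/
abbrev Plane : Type := EuclideanSpace ℝ (Fin 2)

/-! ### The Grassmannian bundle -/

/-- The one-dimensional linear subspaces of the plane. -/
def Line : Type := {L : Submodule ℝ Plane // Module.finrank ℝ L = 1}

/-- The orthogonal projection of the plane onto a line. -/
def Line.proj (L : Line) : Plane →L[ℝ] Plane := L.1.starProjection

theorem Line.proj_injective : Function.Injective Line.proj := by
  intro L M h
  apply Subtype.ext
  ext v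
  rw [← Submodule.starProjection_eq_self_iff (K := L.1),
    ← Submodule.starProjection_eq_self_iff (K := M.1)]
  change Line.proj L v = v ↔ Line.proj M v = v
  rw [h]

/-- The distance of two lines is the distance of the corresponding projection matrices. -/
instance : MetricSpace Line := MetricSpace.induced Line.proj Line.proj_injective inferInstance

instance : MeasurableSpace Line := borel Line

instance : BorelSpace Line := ⟨rfl⟩

instance : Nonempty Line :=
  ⟨⟨Submodule.span ℝ {EuclideanSpace.single (0 : Fin 2) (1 : ℝ)},
    finrank_span_singleton (by simp)⟩⟩

/-- The space `ℝ² × {1-dimensional subspaces of ℝ²}`. A (1-dimensional) varifold in `ℝ²` is a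
finite Borel measure on it. -/
abbrev Grass : Type := Plane × Line

/-- The weight measure `μ_V` on `ℝ²` induced by `V`. -/
def weight (V : Measure Grass) : Measure Plane := V.map Prod.fst

/-! ### Rectifiable varifolds -/

/-- The measure `θ ℋ¹⌞Γ`. -/
def weightedLength (Γ : Set Plane) (θ : Plane → ℝ≥0∞) : Measure Plane :=
  (μH[1].restrict Γ).withDensity θ

/-- `L` is the approximate tangent line at `x` of `Γ` with respect to the multiplicity `θ`: the
blow-ups of `θ ℋ¹⌞Γ` at `x` converge weakly to `θ(x) ℋ¹⌞L`. -/
def IsApproxTangent (Γ : Set Plane) (θ : Plane → ℝ≥0∞) (x : Plane) (L : Line) : Prop :=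
  ∀ f : Plane → ℝ, Continuous f → HasCompactSupport f →
    Tendsto (fun r : ℝ => r⁻¹ * ∫ y, f (r⁻¹ • (y - x)) ∂(weightedLength Γ θ)) (𝓝[>] 0)
      (𝓝 ((θ x).toReal * ∫ y in (L.1 : Set Plane), f y ∂μH[1]))

/-- `T` is a Borel choice of the tangent lines `x ↦ T_x Γ`, for `ℋ¹`-almost every `x ∈ Γ`. -/
def IsTangentField (Γ : Set Plane) (θ : Plane → ℝ≥0∞) (T : Plane → Line) : Prop :=
  Measurable T ∧ ∀ᵐ x ∂(μH[1].restrict Γ), IsApproxTangent Γ θ x (T x)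

open Classical in
/-- The tangent lines `x ↦ T_x Γ`. Where `θ` is positive and finite they are unique, and for a
countably 1-rectifiable `Γ` with finite `θ ℋ¹⌞Γ` they exist almost everywhere and are measurable
in `x`; for other `Γ` the value is a constant line, which is never used. -/
def tangentField (Γ : Set Plane) (θ : Plane → ℝ≥0∞) : Plane → Line :=
  if h : ∃ T, IsTangentField Γ θ T then h.choose else fun _ => Classical.arbitrary Line

/-- The rectifiable varifold `v(Γ, θ)`:
`∫ φ d v(Γ, θ) = ∫_Γ φ(x, T_x Γ) θ(x) dℋ¹(x)`. -/
def varifold (Γ : Set Plane) (θ : Plane → ℝ≥0∞) : Measure Grass :=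
  (weightedLength Γ θ).map (fun x => (x, tangentField Γ θ x))

/-- Countably 1-rectifiable subsets of the plane. -/
def CountablyRectifiable (Γ : Set Plane) : Prop :=
  ∃ f : ℕ → ℝ → Plane, (∀ j, ∃ K : ℝ≥0, LipschitzWith K (f j)) ∧
    μH[1] (Γ \ ⋃ j, range (f j)) = 0

/-- `V` is the integer rectifiable varifold `v(Γ, θ)`: the set `Γ` is `ℋ¹`-measurable and
countably 1-rectifiable, `θ` is `ℋ¹`-measurable on `Γ` with values in the positive integers
almost everywhere on `Γ`, and `V = v(Γ, θ)` is finite. -/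
structure IsIntegerRectifiable (V : Measure Grass) (Γ : Set Plane) (θ : Plane → ℕ) : Prop where
  nullMeasurable : NullMeasurableSet Γ (μH[1] : Measure Plane)
  rectifiable : CountablyRectifiable Γ
  aemeasurable : AEMeasurable θ (μH[1].restrict Γ)
  one_le : ∀ᵐ x ∂(μH[1].restrict Γ), 1 ≤ θ x
  finite : IsFiniteMeasure V
  eq_varifold : V = varifold Γ (fun x => (θ x : ℝ≥0∞))

/-! ### First variation, generalized curvature and boundary -/

/-- The tangential divergence `div_L X (x) = tr(π_L ∘ DX(x))`. -/
def tangentialDiv (L : Line) (X : Plane → Plane) (x : Plane) : ℝ :=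
  LinearMap.trace ℝ Plane ((L.proj ∘L fderiv ℝ X x : Plane →L[ℝ] Plane) : Plane →ₗ[ℝ] Plane)

/-- `V` has the generalized curvature vector `k ∈ L¹_loc(μ_V)` and the generalized boundary `σ`,
a finite `ℝ²`-valued measure that is singular with respect to `μ_V`. For a rectifiable varifold
`V = v(Γ, θ)` the left-hand side of the identity is `∫ div_{T_x Γ} X dμ_V(x)`. -/
structure HasGeneralizedCurvature (V : Measure Grass) (k : Plane → Plane)
    (σ : VectorMeasure Plane Plane) : Prop where
  locallyIntegrable : LocallyIntegrable k (weight V)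
  mutuallySingular : VectorMeasure.MutuallySingular σ (weight V).toENNRealVectorMeasure
  firstVariation : ∀ X : Plane → Plane, ContDiff ℝ 1 X → HasCompactSupport X →
    ∫ z, tangentialDiv z.2 X z.1 ∂V
      = - ∫ x, inner ℝ (X x) (k x) ∂(weight V) + σ.integral X (innerSL ℝ)

open Classical in
/-- `ℰ_p(V) = ∫ |k_V|^p dμ_V` if `V` has generalized curvature `k_V`, and `+∞` otherwise. -/
def varifoldEnergy (p : ℝ) (V : Measure Grass) : ℝ≥0∞ :=
  if h : ∃ k σ, HasGeneralizedCurvature V k σ then ∫⁻ x, ‖h.choose x‖ₑ ^ p ∂(weight V) else ⊤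

/-- `ℱ_p(V) = μ_V(ℝ²) + ℰ_p(V)`. -/
def varifoldTotalEnergy (p : ℝ) (V : Measure Grass) : ℝ≥0∞ :=
  weight V univ + varifoldEnergy p V

/-! ### Closed curves

A function on `S¹ = [0, 2π]/(0 ∼ 2π)` is a `2π`-periodic function on `ℝ`. -/

/-- The Lebesgue measure on `S¹`. -/
def circleMeasure : Measure ℝ := volume.restrict (Ioc 0 (2 * Real.pi))

/-- `g` is a weak derivative of `f` on `S¹`. -/
structure IsWeakDeriv (f g : ℝ → Plane) : Prop where
  integrable_left : Integrable f circleMeasure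
  integrable_right : Integrable g circleMeasure
  integral_eq : ∀ φ : ℝ → ℝ, ContDiff ℝ ∞ φ → Function.Periodic φ (2 * Real.pi) →
    ∫ t, deriv φ t • f t ∂circleMeasure = - ∫ t, φ t • g t ∂circleMeasure

open Classical in
/-- The weak derivative on `S¹` (unique up to null sets), if there is one. -/
def weakDeriv (f : ℝ → Plane) : ℝ → Plane :=
  if h : ∃ g, IsWeakDeriv f g then h.choose else 0

/-- The Sobolev space `W^{2,p}(S¹; ℝ²)`. -/
def MemW2 (p : ℝ) (γ : ℝ → Plane) : Prop :=
  Function.Periodic γ (2 * Real.pi) ∧ MemLp γ (ENNReal.ofReal p) circleMeasure ∧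
    ∃ g h : ℝ → Plane, IsWeakDeriv γ g ∧ MemLp g (ENNReal.ofReal p) circleMeasure ∧
      IsWeakDeriv g h ∧ MemLp h (ENNReal.ofReal p) circleMeasure

/-- A regular closed curve of class `W^{2,p}`, given by its `C¹` representative. -/
structure IsRegularW2Curve (p : ℝ) (γ : ℝ → Plane) : Prop where
  memW2 : MemW2 p γ
  contDiff : ContDiff ℝ 1 γ
  regular : ∀ t, deriv γ t ≠ 0

/-- The curvature vector `k_γ = |γ'|⁻² (γ'' - ⟨γ'', τ⟩ τ)`, `τ = γ'/|γ'|`, that is, the second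
derivative with respect to arclength. Here `γ''` is the weak derivative of `γ'`. -/
def curvature (γ : ℝ → Plane) (t : ℝ) : Plane :=
  (‖deriv γ t‖ ^ 2)⁻¹ • (weakDeriv (deriv γ) t
    - (inner ℝ (weakDeriv (deriv γ) t) (deriv γ t) / ‖deriv γ t‖ ^ 2) • deriv γ t)

/-- `ℰ_p(γ) = ∫_{S¹} |k_γ|^p |γ'| dt`. -/
def curveEnergy (p : ℝ) (γ : ℝ → Plane) : ℝ≥0∞ :=
  ∫⁻ t, ‖curvature γ t‖ₑ ^ p * ‖deriv γ t‖ₑ ∂circleMeasure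

/-- The preimage `γ⁻¹(x)` in `S¹`, each point being represented in `[0, 2π)`. -/
def fiber (γ : ℝ → Plane) (x : Plane) : Set ℝ := {t ∈ Ico 0 (2 * Real.pi) | γ t = x}

/-- The image varifold `γ_♯(v(S¹, 1)) = v(γ(S¹), x ↦ ♯ γ⁻¹(x))`. -/
def imageVarifold (γ : ℝ → Plane) : Measure Grass :=
  varifold (γ '' Ico 0 (2 * Real.pi)) (fun x => ((fiber γ x).encard : ℝ≥0∞))

/-- The vector field `x ↦ θ(x)⁻¹ ∑_i ∑_{t ∈ γ_i⁻¹(x)} k_{γ_i}(t)`. -/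
def averagedCurvature {N : ℕ} (θ : Plane → ℕ) (γ : Fin N → ℝ → Plane) (x : Plane) : Plane :=
  ((θ x : ℝ))⁻¹ • ∑ i, ∑ᶠ t ∈ fiber (γ i) x, curvature (γ i) t

end ElasticVarifold

end

/-!
A closed curve `γ` carries its arclength measure `lengthMeasure γ` on the parameter interval. A
regular curve is injective and almost linear on short arcs, which gives the area formula
`IsRegularW2Curve.map_lengthMeasure`: the curve pushes this measure to `ℋ¹` weighted with the number
of preimages.

* *Tangents.* A blow-up computation on the finitely many arcs through a point shows that
  `span γ'(t)` is the approximate tangent line of the image varifold at `γ t` for almost every `t`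
  (`IsRegularW2Curve.ae_isApproxTangent`). Hence the image varifold is the image of the arclength
  measure under `t ↦ (γ t, span γ'(t))` (`IsRegularW2Curve.imageVarifold_eq`), and integrals against
  it become integrals along the curve.
* *First variation.* The unit tangent is absolutely continuous with derivative `|γ'| k_γ`, so
  integration by parts on the circle gives the first variation of a single curve
  (`IsRegularW2Curve.firstVariation`); there is no boundary term by periodicity.
* *Locality of curvature.* For two curves `γ`, `η`, at `ℋ¹`-almost every common point
  `γ t = η s` the tangents are parallel and the curvatures coincide
  (`IsRegularW2Curve.ae_curvature_eq`): all but countably many common points are limits of further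
  common points, and comparing the second order Taylor expansions of both curves along such a
  sequence forces equality. Therefore the average over all preimages is an average of equal
  vectors, and it equals `k_γ` along each of the curves
  (`IsIntegerRectifiable.ae_averagedCurvature_eq`). Summing the first variations of the curves
  yields the generalized curvature, and integrating `|k|^p` along the curves yields the energy.
* *Uniqueness.* A locally integrable density and a measure singular to it that agree as
  distributions both vanish (`eq_zero_of_forall_integral_inner_eq`), by the Jordan decomposition of
  the components and the fundamental lemma of the calculus of variations. So `varifoldEnergy`,
  which is defined through an arbitrary generalized curvature, is computed by the averaged one; as
  it depends on the varifold alone, so does the sum of the energies of the curves.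
-/

namespace ElasticVarifold

/-! ### Absolutely continuous functions with values in a normed space -/

section AbsolutelyContinuous

variable {F : Type*} [NormedAddCommGroup F] {a b : ℝ}

/-- A function whose increments are controlled by those of two absolutely continuous functions is
absolutely continuous. -/
theorem absolutelyContinuousOnInterval_of_dist_le_add {X Y Z : Type*} [PseudoMetricSpace X]
    [PseudoMetricSpace Y] [PseudoMetricSpace Z] {f : ℝ → X} {g : ℝ → Y} {h : ℝ → Z} {K L : ℝ}
    (hg : AbsolutelyContinuousOnInterval g a b) (hh : AbsolutelyContinuousOnInterval h a b)
    (H : ∀ s ∈ uIcc a b, ∀ t ∈ uIcc a b,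
      dist (f s) (f t) ≤ K * dist (g s) (g t) + L * dist (h s) (h t)) :
    AbsolutelyContinuousOnInterval f a b := by
  have hlim := (Tendsto.const_mul K hg).add (Tendsto.const_mul L hh)
  rw [mul_zero, mul_zero, add_zero] at hlim
  refine squeeze_zero' (Eventually.of_forall fun _ => Finset.sum_nonneg fun _ _ => dist_nonneg)
    ?_ hlim
  filter_upwards [mem_inf_of_right (mem_principal_self _)] with E hE
  rw [Finset.mul_sum, Finset.mul_sum, ← Finset.sum_add_distrib]
  exact Finset.sum_le_sum fun i hi => H _ (hE.1 i hi).1 _ (hE.1 i hi).2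

theorem absolutelyContinuousOnInterval_of_dist_le {X Y : Type*} [PseudoMetricSpace X]
    [PseudoMetricSpace Y] {f : ℝ → X} {g : ℝ → Y} {K : ℝ}
    (hg : AbsolutelyContinuousOnInterval g a b)
    (h : ∀ s ∈ uIcc a b, ∀ t ∈ uIcc a b, dist (f s) (f t) ≤ K * dist (g s) (g t)) :
    AbsolutelyContinuousOnInterval f a b :=
  absolutelyContinuousOnInterval_of_dist_le_add (L := 0) hg hg (by simpa using h)

variable [NormedSpace ℝ F] [CompleteSpace F]

omit [CompleteSpace F] in
theorem dist_integral_le_dist_integral {h : ℝ → F} {c : ℝ}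
    (hh : IntervalIntegrable h volume a b) (hc : c ∈ uIcc a b) :
    ∀ s ∈ uIcc a b, ∀ t ∈ uIcc a b,
      dist (∫ x in c..s, h x) (∫ x in c..t, h x)
        ≤ 1 * dist (∫ x in c..s, ‖h x‖) (∫ x in c..t, ‖h x‖) := by
  intro s hs t ht
  have I1 : ∀ u ∈ uIcc a b, IntervalIntegrable h volume c u := fun u hu =>
    hh.mono_set (uIcc_subset_uIcc hc hu)
  rw [dist_eq_norm, dist_eq_norm, intervalIntegral.integral_interval_sub_left (I1 s hs) (I1 t ht),
    intervalIntegral.integral_interval_sub_left (I1 s hs).norm (I1 t ht).norm, one_mul,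
    Real.norm_eq_abs]
  exact intervalIntegral.norm_integral_le_abs_integral_norm

omit [CompleteSpace F] in
theorem absolutelyContinuousOnInterval_integral {h : ℝ → F} {c : ℝ}
    (hh : IntervalIntegrable h volume a b) (hc : c ∈ uIcc a b) :
    AbsolutelyContinuousOnInterval (fun t => ∫ x in c..t, h x) a b :=
  absolutelyContinuousOnInterval_of_dist_le
    (hh.norm.absolutelyContinuousOnInterval_intervalIntegral hc)
    (dist_integral_le_dist_integral hh hc)

/-- The fundamental theorem of calculus for an absolutely continuous function with values in a
Banach space whose almost everywhere derivative is given. -/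
theorem integral_eq_sub_of_absolutelyContinuous {f f' : ℝ → F}
    (hf : AbsolutelyContinuousOnInterval f a b) (hf' : IntervalIntegrable f' volume a b)
    (hd : ∀ᵐ x, x ∈ uIcc a b → HasDerivAt f (f' x) x) :
    ∫ x in a..b, f' x = f b - f a := by
  have hac := hf.sub (absolutelyContinuousOnInterval_integral hf' (left_mem_uIcc (a := a) (b := b)))
  obtain ⟨C, hC⟩ := hac.const_of_ae_hasDerivAt_zero (by
    filter_upwards [hd, hf'.ae_hasDerivAt_integral] with x h1 h2 hx
    simpa using (h1 hx).sub (h2 hx a left_mem_uIcc))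
  have h1 := hC a left_mem_uIcc
  have h2 := hC b right_mem_uIcc
  simp only [Pi.sub_apply, intervalIntegral.integral_same, sub_zero] at h1 h2
  rw [h1, ← h2]
  abel

end AbsolutelyContinuous

/-! ### Weak derivatives on the circle -/

theorem circle_pos : (0 : ℝ) < 2 * Real.pi := by positivity

instance : IsFiniteMeasure circleMeasure := by unfold circleMeasure; infer_instance

theorem integral_circleMeasure {F : Type*} [NormedAddCommGroup F] [NormedSpace ℝ F] (f : ℝ → F) :
    ∫ t, f t ∂circleMeasure = ∫ t in (0)..(2 * Real.pi), f t := by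
  rw [circleMeasure, intervalIntegral.integral_of_le circle_pos.le]

theorem intervalIntegrable_of_circle {F : Type*} [NormedAddCommGroup F] {f : ℝ → F}
    (hf : Integrable f circleMeasure) : IntervalIntegrable f volume 0 (2 * Real.pi) :=
  (intervalIntegrable_iff_integrableOn_Ioc_of_le circle_pos.le).2 hf

theorem integrable_circleMeasure_of_continuous {F : Type*} [NormedAddCommGroup F] {f : ℝ → F}
    (hf : Continuous f) : Integrable f circleMeasure :=
  (intervalIntegrable_iff_integrableOn_Ioc_of_le circle_pos.le).1
    (hf.intervalIntegrable 0 (2 * Real.pi))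

/-- Almost every point of the circle lies in the open interval `(0, 2π)`. -/
theorem ae_circleMeasure_mem_Ioo : ∀ᵐ t ∂circleMeasure, t ∈ Ioo 0 (2 * Real.pi) := by
  rw [circleMeasure, ← restrict_Ioo_eq_restrict_Ioc]
  exact ae_restrict_mem measurableSet_Ioo

/-- A smooth function with support in an open period extends to a smooth periodic function. -/
theorem exists_periodic_extension {T : ℝ} (hT : 0 < T) {g : ℝ → ℝ} (hg : ContDiff ℝ ∞ g)
    (hs : tsupport g ⊆ Ioo 0 T) :
    ∃ ψ : ℝ → ℝ, ContDiff ℝ ∞ ψ ∧ Function.Periodic ψ T ∧ ∀ t ∈ Icc 0 T, ψ t = g t := by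
  have hz : ∀ t, t ∉ Ioo 0 T → g t = 0 := fun t ht =>
    image_eq_zero_of_notMem_tsupport fun h => ht (hs h)
  have hloc : ∀ (k : ℤ) (t : ℝ), t ∈ Ioo ((k - 1 : ℝ) * T) ((k + 1 : ℝ) * T) →
      g (T * Int.fract (t / T)) = g (t - k * T) + g (t - k * T + T) := by
    intro k t ht
    have e : T * Int.fract (t / T) = t - ⌊t / T⌋ * T := by
      rw [Int.fract]; field_simp
    rw [e]
    by_cases h : k * T ≤ t
    · have hfl : ⌊t / T⌋ = k := by
        rw [Int.floor_eq_iff, le_div_iff₀ hT, div_lt_iff₀ hT]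
        exact ⟨h, ht.2⟩
      rw [hfl, hz (t - k * T + T) (fun h' => by linarith [h'.2]), add_zero]
    · push Not at h
      have hfl : ⌊t / T⌋ = k - 1 := by
        rw [Int.floor_eq_iff, le_div_iff₀ hT, div_lt_iff₀ hT]
        push_cast
        exact ⟨ht.1.le, by linarith⟩
      rw [hfl, hz (t - k * T) (fun h' => by linarith [h'.1]), zero_add]
      congr 1
      push_cast
      ring
  refine ⟨fun t => g (T * Int.fract (t / T)), ?_, ?_, ?_⟩
  · rw [contDiff_iff_contDiffAt]
    intro t₀
    set k : ℤ := ⌊t₀ / T⌋ with hk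
    have hm : t₀ ∈ Ioo ((k - 1 : ℝ) * T) ((k + 1 : ℝ) * T) := by
      have h1 : (k : ℝ) * T ≤ t₀ := (le_div_iff₀ hT).1 (Int.floor_le _)
      have h2 : t₀ < (k + 1) * T := (div_lt_iff₀ hT).1 (Int.lt_floor_add_one _)
      exact ⟨by linarith, h2⟩
    have hsm : ContDiffAt ℝ ∞ (fun t => g (t - k * T) + g (t - k * T + T)) t₀ := by fun_prop
    refine hsm.congr_of_eventuallyEq ?_
    filter_upwards [isOpen_Ioo.mem_nhds hm] with t ht using hloc k t ht
  · intro t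
    have : (t + T) / T = t / T + 1 := by field_simp
    simp only [this, Int.fract_add_one]
  · intro t ht
    have h := hloc 0 t
    rcases eq_or_ne t T with rfl | hne
    · simp only [div_self hT.ne', Int.fract_one, mul_zero]
      rw [hz 0 (by simp), hz t (by simp)]
    · have ht' : t < T := lt_of_le_of_ne ht.2 hne
      have := h ⟨by push_cast; linarith [ht.1], by push_cast; linarith⟩
      simp only [this, Int.cast_zero, zero_mul, sub_zero]
      rw [hz (t + T) (fun h' => by linarith [h'.2, ht.1]), add_zero]

/-- The du Bois-Reymond lemma on the circle: a continuous periodic function is the primitive of its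
weak derivative. -/
theorem IsWeakDeriv.eq_add_integral {f h : ℝ → Plane} (H : IsWeakDeriv f h) (hf : Continuous f)
    (hp : Function.Periodic f (2 * Real.pi)) :
    ∀ t ∈ Icc 0 (2 * Real.pi), f t = f 0 + ∫ x in (0)..t, h x := by
  have hπ := circle_pos
  have hI := intervalIntegrable_of_circle H.integrable_right
  have hf0 : f (2 * Real.pi) = f 0 := by simpa using hp 0
  have h1 : ∫ x in (0)..(2 * Real.pi), h x = 0 := by
    have := H.integral_eq (fun _ => 1) contDiff_const (fun _ => rfl)
    simp only [deriv_const', zero_smul, integral_zero, one_smul, integral_circleMeasure] at this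
    exact neg_eq_zero.1 this.symm
  set P : ℝ → Plane := fun t => ∫ x in (0)..t, h x with hP
  have hPac : AbsolutelyContinuousOnInterval P 0 (2 * Real.pi) :=
    absolutelyContinuousOnInterval_integral hI left_mem_uIcc
  have hPc : ContinuousOn P (Icc 0 (2 * Real.pi)) := by
    simpa [uIcc_of_le hπ.le] using hPac.continuousOn
  set u : ℝ → Plane := fun t => f t - P t with hu
  have huc : ContinuousOn u (Icc 0 (2 * Real.pi)) := hf.continuousOn.sub hPc
  have hui : IntervalIntegrable u volume 0 (2 * Real.pi) :=
    ContinuousOn.intervalIntegrable (by rwa [uIcc_of_le hπ.le])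
  -- the primitive has the same weak derivative, so the difference is orthogonal to derivatives
  have hortho : ∀ φ : ℝ → ℝ, ContDiff ℝ ∞ φ → Function.Periodic φ (2 * Real.pi) →
      ∫ t in (0)..(2 * Real.pi), deriv φ t • u t = 0 := by
    intro φ hφ hφp
    have hφc : Continuous φ := hφ.continuous
    have hφ'c : Continuous (deriv φ) := hφ.continuous_deriv (by simp)
    have hw := H.integral_eq φ hφ hφp
    rw [integral_circleMeasure, integral_circleMeasure] at hw
    have hiA : IntervalIntegrable (fun t => deriv φ t • P t) volume 0 (2 * Real.pi) :=
      (ContinuousOn.intervalIntegrable (by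
        rw [uIcc_of_le hπ.le]; exact hφ'c.continuousOn.smul hPc))
    have hiB : IntervalIntegrable (fun t => φ t • h t) volume 0 (2 * Real.pi) :=
      hI.continuousOn_smul hφc.continuousOn
    have hparts : ∫ t in (0)..(2 * Real.pi), (deriv φ t • P t + φ t • h t) = 0 := by
      rw [integral_eq_sub_of_absolutelyContinuous (f := fun t => φ t • P t)]
      · simp [hP, h1]
      · exact AbsolutelyContinuousOnInterval.fun_smul
          (ContDiffOn.absolutelyContinuousOnInterval (hφ.of_le (by simp)).contDiffOn) hPac
      · exact hiA.add hiB
      · filter_upwards [hI.ae_hasDerivAt_integral] with t ht htm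
        rw [add_comm]
        exact (hφ.differentiable (by simp) t).hasDerivAt.smul (ht htm 0 left_mem_uIcc)
    rw [intervalIntegral.integral_add hiA hiB] at hparts
    simp only [hu, smul_sub]
    have hiC : IntervalIntegrable (fun t => deriv φ t • f t) volume 0 (2 * Real.pi) :=
      (hφ'c.smul hf).intervalIntegrable _ _
    rw [intervalIntegral.integral_sub hiC hiA, hw,
      eq_neg_of_add_eq_zero_left hparts, sub_self]
  set m : Plane := (2 * Real.pi)⁻¹ • ∫ t in (0)..(2 * Real.pi), u t with hm
  have hae : ∀ᵐ t, t ∈ Ioo 0 (2 * Real.pi) → u t - m = 0 := by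
    refine isOpen_Ioo.ae_eq_zero_of_integral_contDiff_smul_eq_zero
      (((huc.sub continuousOn_const).mono Ioo_subset_Icc_self).locallyIntegrableOn
        measurableSet_Ioo) ?_
    intro g hg _ hgs
    obtain ⟨ψ, hψ, hψp, hψg⟩ := exists_periodic_extension hπ hg hgs
    have hψc := hψ.continuous
    set c : ℝ := (2 * Real.pi)⁻¹ * ∫ t in (0)..(2 * Real.pi), ψ t with hc
    have hcont : Continuous fun t => ψ t - c := hψc.sub continuous_const
    have hder : ∀ t, HasDerivAt (fun t => ∫ x in (0)..t, (ψ x - c)) (ψ t - c) t := fun t =>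
      intervalIntegral.integral_hasDerivAt_right (hcont.intervalIntegrable _ _)
        (hcont.stronglyMeasurableAtFilter _ _) hcont.continuousAt
    have hzero : ∫ x in (0)..(2 * Real.pi), (ψ x - c) = 0 := by
      rw [intervalIntegral.integral_sub (hψc.intervalIntegrable _ _)
        (continuous_const.intervalIntegrable _ _), intervalIntegral.integral_const, hc]
      simp only [sub_zero, smul_eq_mul]
      field_simp
      ring
    have key := hortho (fun t => ∫ x in (0)..t, (ψ x - c)) (by
        rw [contDiff_infty_iff_deriv]
        refine ⟨fun t => (hder t).differentiableAt, ?_⟩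
        rw [show deriv (fun t => ∫ x in (0)..t, (ψ x - c)) = fun t => ψ t - c from
          funext fun t => (hder t).deriv]
        exact hψ.sub contDiff_const) (by
        intro t
        have hper : Function.Periodic (fun x => ψ x - c) (2 * Real.pi) := fun x => by
          simp only [hψp x]
        have := hper.intervalIntegral_add_eq t 0
        simp only [zero_add] at this
        show ∫ x in (0)..(t + 2 * Real.pi), (ψ x - c) = ∫ x in (0)..t, (ψ x - c)
        rw [← intervalIntegral.integral_add_adjacent_intervals
          (hcont.intervalIntegrable 0 t) (hcont.intervalIntegrable t _), this, hzero, add_zero])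
    simp only [(hder _).deriv, sub_smul] at key
    have hiψ : IntervalIntegrable (fun t => ψ t • u t) volume 0 (2 * Real.pi) :=
      hui.continuousOn_smul hψc.continuousOn
    have hic : IntervalIntegrable (fun t => c • u t) volume 0 (2 * Real.pi) := hui.smul c
    have him : IntervalIntegrable (fun t => ψ t • m) volume 0 (2 * Real.pi) :=
      (hψc.smul continuous_const).intervalIntegrable _ _
    rw [intervalIntegral.integral_sub hiψ hic, intervalIntegral.integral_smul] at key
    have hset : ∫ t, g t • (u t - m) = ∫ t in (0)..(2 * Real.pi), ψ t • (u t - m) := by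
      rw [intervalIntegral.integral_of_le hπ.le]
      rw [← setIntegral_eq_integral_of_forall_compl_eq_zero (s := Ioc 0 (2 * Real.pi))]
      · exact setIntegral_congr_fun measurableSet_Ioc fun t ht => by
          simp only [hψg t ⟨ht.1.le, ht.2⟩]
      · intro t ht
        rw [image_eq_zero_of_notMem_tsupport (fun h' => ht (Ioo_subset_Ioc_self (hgs h'))),
          zero_smul]
    rw [hset]
    simp only [smul_sub]
    rw [intervalIntegral.integral_sub hiψ him,
      intervalIntegral.integral_smul_const, sub_eq_zero.1 key, hc, hm, smul_smul, mul_comm,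
      sub_self]
  -- continuity upgrades the almost everywhere identity
  have hcl : ∀ t ∈ Icc 0 (2 * Real.pi), u t = m := by
    have hEq : EqOn u (fun _ => m) (Ioo 0 (2 * Real.pi)) := by
      refine Measure.eqOn_open_of_ae_eq (μ := volume) ?_ isOpen_Ioo (huc.mono Ioo_subset_Icc_self)
        continuousOn_const
      rw [EventuallyEq, ae_restrict_iff' measurableSet_Ioo]
      filter_upwards [hae] with t ht htm using sub_eq_zero.1 (ht htm)
    have := hEq.of_subset_closure huc continuousOn_const Ioo_subset_Icc_self
      (by rw [closure_Ioo hπ.ne])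
    exact fun t ht => this ht
  intro t ht
  have e0 := hcl 0 ⟨le_rfl, hπ.le⟩
  have et := hcl t ht
  simp only [hu, hP, intervalIntegral.integral_same, sub_zero] at e0 et
  rw [e0, ← et]
  abel

/-- At almost every point the weak derivative of a continuous function is its derivative. -/
theorem IsWeakDeriv.ae_hasDerivAt {f h : ℝ → Plane} (H : IsWeakDeriv f h) (hf : Continuous f)
    (hp : Function.Periodic f (2 * Real.pi)) :
    ∀ᵐ t ∂circleMeasure, HasDerivAt f (h t) t := by
  have hI := intervalIntegrable_of_circle H.integrable_right
  filter_upwards [ae_circleMeasure_mem_Ioo, ae_restrict_of_ae hI.ae_hasDerivAt_integral]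
    with t ht hd
  have := (hd (by rw [uIcc_of_le circle_pos.le]; exact Ioo_subset_Icc_self ht) 0
    left_mem_uIcc).const_add (f 0)
  refine this.congr_of_eventuallyEq ?_
  filter_upwards [isOpen_Ioo.mem_nhds ht] with s hs
  exact H.eq_add_integral hf hp s (Ioo_subset_Icc_self hs)

theorem periodic_deriv {γ : ℝ → Plane} {T : ℝ} (h : Function.Periodic γ T) :
    Function.Periodic (deriv γ) T := by
  intro t
  rw [← deriv_comp_add_const]
  congr 1
  exact funext h

/-! ### The second derivative of a regular curve -/

section Curve

variable {p : ℝ} {γ : ℝ → Plane}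

theorem IsRegularW2Curve.continuous_deriv (hγ : IsRegularW2Curve p γ) : Continuous (deriv γ) :=
  hγ.contDiff.continuous_deriv le_rfl

theorem IsRegularW2Curve.hasDerivAt (hγ : IsRegularW2Curve p γ) (t : ℝ) :
    HasDerivAt γ (deriv γ t) t :=
  (hγ.contDiff.differentiable (by simp) t).hasDerivAt

theorem IsRegularW2Curve.periodic_deriv (hγ : IsRegularW2Curve p γ) :
    Function.Periodic (deriv γ) (2 * Real.pi) := ElasticVarifold.periodic_deriv hγ.memW2.1

/-- The classical derivative of a regular curve has a weak derivative. -/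
theorem IsRegularW2Curve.isWeakDeriv (hγ : IsRegularW2Curve p γ) :
    IsWeakDeriv (deriv γ) (weakDeriv (deriv γ)) := by
  obtain ⟨hp, -, g, h, hg, -, hh, -⟩ := hγ.memW2
  have hgae : g =ᵐ[circleMeasure] deriv γ := by
    filter_upwards [hg.ae_hasDerivAt hγ.contDiff.continuous hp] with t ht using ht.deriv.symm
  have hex : ∃ h, IsWeakDeriv (deriv γ) h := by
    refine ⟨h, hh.integrable_left.congr hgae, hh.integrable_right, fun φ hφ hφp => ?_⟩
    rw [← hh.integral_eq φ hφ hφp]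
    refine integral_congr_ae ?_
    filter_upwards [hgae] with t ht
    rw [ht]
  rw [weakDeriv, dif_pos hex]
  exact hex.choose_spec

theorem IsRegularW2Curve.integrable_weakDeriv (hγ : IsRegularW2Curve p γ) :
    Integrable (weakDeriv (deriv γ)) circleMeasure := hγ.isWeakDeriv.integrable_right

theorem IsRegularW2Curve.deriv_eq_add_integral (hγ : IsRegularW2Curve p γ) :
    ∀ t ∈ Icc 0 (2 * Real.pi),
      deriv γ t = deriv γ 0 + ∫ x in (0)..t, weakDeriv (deriv γ) x :=
  hγ.isWeakDeriv.eq_add_integral hγ.continuous_deriv hγ.periodic_deriv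

theorem IsRegularW2Curve.ae_hasDerivAt_deriv (hγ : IsRegularW2Curve p γ) :
    ∀ᵐ t ∂circleMeasure, HasDerivAt (deriv γ) (weakDeriv (deriv γ) t) t :=
  hγ.isWeakDeriv.ae_hasDerivAt hγ.continuous_deriv hγ.periodic_deriv

end Curve

/-! ### The area formula for regular curves -/

section Partition

/-- A partition of `[0, 2π]` into intervals of length at most `δ`. -/
theorem exists_partition {δ : ℝ} (hδ : 0 < δ) :
    ∃ (n : ℕ) (s : ℕ → ℝ), Monotone s ∧ s 0 = 0 ∧ s n = 2 * Real.pi ∧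
      ∀ k, s (k + 1) - s k ≤ δ := by
  obtain ⟨n, hn⟩ := exists_nat_gt (2 * Real.pi / δ)
  have hn0 : (0 : ℝ) < n := lt_of_le_of_lt (by positivity) hn
  refine ⟨n, fun k => 2 * Real.pi * k / n, ?_, by simp, by field_simp, fun k => ?_⟩
  · intro i j hij
    dsimp only
    gcongr
  · rw [div_lt_iff₀ hδ] at hn
    have : 2 * Real.pi * ((k + 1 : ℕ) : ℝ) / n - 2 * Real.pi * k / n = 2 * Real.pi / n := by
      push_cast; ring
    rw [this, div_le_iff₀ hn0]
    linarith

theorem restrict_Ico_eq_sum (μ : Measure ℝ) {s : ℕ → ℝ} (hs : Monotone s) (n : ℕ) :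
    μ.restrict (Ico (s 0) (s n)) = ∑ k ∈ Finset.range n, μ.restrict (Ico (s k) (s (k + 1))) := by
  induction n with
  | zero => simp
  | succ n ih =>
    rw [Finset.sum_range_succ, ← ih, ← Measure.restrict_union _ measurableSet_Ico,
      Ico_union_Ico_eq_Ico (hs (zero_le)) (hs n.le_succ)]
    exact Ico_disjoint_Ico_same

theorem circleMeasure_eq_restrict_Ico :
    circleMeasure = volume.restrict (Ico 0 (2 * Real.pi)) := by
  rw [circleMeasure, ← restrict_Ioo_eq_restrict_Ioc, restrict_Ioo_eq_restrict_Ico]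

/-- If a curve is injective on the intervals of a partition, then the number of preimages of a
point is the number of arcs through it. -/
theorem encard_fiber_eq_sum {γ : ℝ → Plane} {n : ℕ} {s : ℕ → ℝ} (hs : Monotone s) (h0 : s 0 = 0)
    (hn : s n = 2 * Real.pi) (hinj : ∀ k < n, InjOn γ (Ico (s k) (s (k + 1)))) (x : Plane) :
    ((fiber γ x).encard : ℝ≥0∞) =
      ∑ k ∈ Finset.range n, (γ '' Ico (s k) (s (k + 1))).indicator 1 x := by
  have hm : ∀ k ∈ Finset.range n, (Measure.count.restrict (Ico (s k) (s (k + 1)))) (γ ⁻¹' {x})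
      = (γ '' Ico (s k) (s (k + 1))).indicator 1 x ∧
      MeasurableSet (γ ⁻¹' {x} ∩ Ico (s k) (s (k + 1))) := by
    intro k hk
    have hsub : (γ ⁻¹' {x} ∩ Ico (s k) (s (k + 1))).Subsingleton := fun t ht u hu =>
      hinj k (Finset.mem_range.1 hk) ht.2 hu.2 (ht.1.trans hu.1.symm)
    refine ⟨?_, hsub.measurableSet⟩
    rw [Measure.restrict_apply' measurableSet_Ico]
    by_cases hx : x ∈ γ '' Ico (s k) (s (k + 1))
    · obtain ⟨t, ht, rfl⟩ := hx
      rw [hsub.eq_singleton_of_mem (x := t) ⟨rfl, ht⟩, Measure.count_singleton,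
        indicator_of_mem (mem_image_of_mem _ ht), Pi.one_apply]
    · rw [indicator_of_notMem hx]
      convert measure_empty (μ := Measure.count (α := ℝ))
      exact eq_empty_of_forall_notMem fun t ht => hx ⟨t, ht.2, ht.1⟩
  have hfib : fiber γ x = γ ⁻¹' {x} ∩ Ico (s 0) (s n) := by
    rw [h0, hn]; ext t; simp [fiber, and_comm]
  have hU : γ ⁻¹' {x} ∩ Ico (s 0) (s n) =
      ⋃ k ∈ Finset.range n, γ ⁻¹' {x} ∩ Ico (s k) (s (k + 1)) := by
    clear hm hfib hn hinj
    induction n with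
    | zero => simp
    | succ n ih =>
      rw [Finset.range_add_one, Finset.set_biUnion_insert, ← ih, ← inter_union_distrib_left,
        union_comm, Ico_union_Ico_eq_Ico (hs zero_le) (hs n.le_succ)]
  have hmeas : MeasurableSet (fiber γ x) := by
    rw [hfib, hU]
    exact Finset.measurableSet_biUnion _ fun k hk => (hm k hk).2
  rw [← Measure.count_apply hmeas, hfib, ← Measure.restrict_apply' measurableSet_Ico,
    restrict_Ico_eq_sum _ hs, Measure.finsetSum_apply]
  exact Finset.sum_congr rfl fun k hk => (hm k hk).1

end Partition

section Area

variable {p : ℝ} {γ : ℝ → Plane}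

theorem IsRegularW2Curve.exists_norm_deriv_bounds (hγ : IsRegularW2Curve p γ) :
    ∃ m M : ℝ, 0 < m ∧ ∀ t, m ≤ ‖deriv γ t‖ ∧ ‖deriv γ t‖ ≤ M := by
  have hc : ContinuousOn (fun t => ‖deriv γ t‖) (Icc 0 (2 * Real.pi)) :=
    hγ.continuous_deriv.norm.continuousOn
  have hne : (Icc 0 (2 * Real.pi)).Nonempty := nonempty_Icc.2 circle_pos.le
  obtain ⟨a, -, ha⟩ := isCompact_Icc.exists_isMinOn hne hc
  obtain ⟨b, -, hb⟩ := isCompact_Icc.exists_isMaxOn hne hc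
  refine ⟨‖deriv γ a‖, ‖deriv γ b‖, norm_pos_iff.2 (hγ.regular a), fun t => ?_⟩
  obtain ⟨y, hy, e⟩ := hγ.periodic_deriv.exists_mem_Ico₀ circle_pos t
  rw [e]
  exact ⟨ha (Ico_subset_Icc_self hy), hb (Ico_subset_Icc_self hy)⟩

theorem IsRegularW2Curve.exists_lipschitz (hγ : IsRegularW2Curve p γ) :
    ∃ K : ℝ≥0, LipschitzWith K γ := by
  obtain ⟨m, M, -, h⟩ := hγ.exists_norm_deriv_bounds
  refine ⟨M.toNNReal, lipschitzWith_of_nnnorm_deriv_le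
    (hγ.contDiff.differentiable (by simp)) fun t => ?_⟩
  rw [← NNReal.coe_le_coe, coe_nnnorm]
  exact (h t).2.trans (Real.le_coe_toNNReal M)

/-- On short intervals a `C¹` curve is almost linear. -/
theorem IsRegularW2Curve.exists_almost_linear (hγ : IsRegularW2Curve p γ) {ε : ℝ} (hε : 0 < ε) :
    ∃ δ > 0, ∀ a b, 0 ≤ a → b ≤ 2 * Real.pi → b - a ≤ δ →
      ∀ c ∈ Icc a b, ∀ s ∈ Icc a b,
        ‖deriv γ s - deriv γ c‖ ≤ ε ∧
        ∀ t ∈ Icc a b, ‖γ s - γ t - (s - t) • deriv γ c‖ ≤ ε * |s - t| := by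
  have huc := (isCompact_Icc (a := (0 : ℝ)) (b := 2 * Real.pi)).uniformContinuousOn_of_continuous
    hγ.continuous_deriv.continuousOn
  obtain ⟨δ, hδ, H⟩ := Metric.uniformContinuousOn_iff_le.1 huc ε hε
  refine ⟨δ, hδ, fun a b ha hb hab c hc s hs => ?_⟩
  have hd : ∀ u ∈ Icc a b, ‖deriv γ u - deriv γ c‖ ≤ ε := fun u hu => by
    rw [← dist_eq_norm]
    refine H u ⟨ha.trans hu.1, hu.2.trans hb⟩ c ⟨ha.trans hc.1, hc.2.trans hb⟩ ?_
    rw [Real.dist_eq, abs_le]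
    constructor <;> linarith [hu.1, hu.2, hc.1, hc.2]
  refine ⟨hd s hs, fun t ht => ?_⟩
  have hder : ∀ u ∈ Icc a b, HasDerivWithinAt (fun u => γ u - u • deriv γ c)
      (deriv γ u - deriv γ c) (Icc a b) u := fun u _ => by
    have := (hγ.hasDerivAt u).sub ((hasDerivAt_id u).smul_const (deriv γ c))
    rw [one_smul] at this
    exact this.hasDerivWithinAt
  have := (convex_Icc a b).norm_image_sub_le_of_norm_hasDerivWithin_le hder hd ht hs
  rw [Real.norm_eq_abs] at this
  rwa [show γ s - γ t - (s - t) • deriv γ c = γ s - s • deriv γ c - (γ t - t • deriv γ c) by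
    rw [sub_smul]; abel]

theorem lipschitzOn_of_almost_linear {A : Set ℝ} {v : Plane} {ε : ℝ} (hε : 0 ≤ ε)
    (h : ∀ s ∈ A, ∀ t ∈ A, ‖γ s - γ t - (s - t) • v‖ ≤ ε * |s - t|) :
    LipschitzOnWith (‖v‖ + ε).toNNReal γ A := by
  refine LipschitzOnWith.of_dist_le_mul fun s hs t ht => ?_
  rw [Real.coe_toNNReal _ (by positivity), dist_eq_norm, Real.dist_eq]
  calc ‖γ s - γ t‖ = ‖(γ s - γ t - (s - t) • v) + (s - t) • v‖ := by rw [sub_add_cancel]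
    _ ≤ ε * |s - t| + |s - t| * ‖v‖ := by
        refine (norm_add_le _ _).trans (add_le_add (h s hs t ht) ?_)
        rw [norm_smul, Real.norm_eq_abs]
    _ = _ := by ring

theorem le_norm_sub_of_almost_linear {v : Plane} {ε s t : ℝ}
    (h : ‖γ s - γ t - (s - t) • v‖ ≤ ε * |s - t|) :
    (‖v‖ - ε) * |s - t| ≤ ‖γ s - γ t‖ := by
  have : ‖(s - t) • v‖ ≤ ‖γ s - γ t‖ + ‖γ s - γ t - (s - t) • v‖ := by
    have := norm_sub_le (γ s - γ t) (γ s - γ t - (s - t) • v)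
    rwa [sub_sub_cancel] at this
  rw [norm_smul, Real.norm_eq_abs] at this
  nlinarith

/-- The length of an arc on which the curve is almost linear, compared to the integral of the
speed. -/
theorem hausdorffMeasure_image_of_almost_linear {A : Set ℝ} (hA : MeasurableSet A) {v : Plane}
    {ε : ℝ} (hε : 0 ≤ ε) (hv : ε < ‖v‖)
    (hd : ∀ s ∈ A, ‖deriv γ s - v‖ ≤ ε)
    (h : ∀ s ∈ A, ∀ t ∈ A, ‖γ s - γ t - (s - t) • v‖ ≤ ε * |s - t|) :
    μH[1] (γ '' A) ≤ (∫⁻ t in A, ‖deriv γ t‖ₑ) + ENNReal.ofReal (2 * ε) * volume A ∧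
    ∫⁻ t in A, ‖deriv γ t‖ₑ ≤ μH[1] (γ '' A) + ENNReal.ofReal (2 * ε) * volume A := by
  have hup : μH[1] (γ '' A) ≤ ENNReal.ofReal (‖v‖ + ε) * volume A := by
    have := (lipschitzOn_of_almost_linear hε h).hausdorffMeasure_image_le zero_le_one
    simpa [hausdorffMeasure_real, ENNReal.ofReal] using this
  have hlow : ENNReal.ofReal (‖v‖ - ε) * volume A ≤ μH[1] (γ '' A) := by
    have hκ : 0 < ‖v‖ - ε := sub_pos.2 hv
    have hinj : InjOn γ A := fun s hs t ht e => by
      have := le_norm_sub_of_almost_linear (h s hs t ht)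
      rw [e, sub_self, norm_zero] at this
      have h2 : |s - t| ≤ 0 := by
        by_contra hc
        push Not at hc
        nlinarith [mul_pos hκ hc]
      exact sub_eq_zero.1 (abs_nonpos_iff.1 h2)
    have hL : LipschitzOnWith (‖v‖ - ε)⁻¹.toNNReal (Function.invFunOn γ A) (γ '' A) := by
      refine LipschitzOnWith.of_dist_le_mul ?_
      rintro _ ⟨s, hs, rfl⟩ _ ⟨t, ht, rfl⟩
      rw [hinj.leftInvOn_invFunOn hs, hinj.leftInvOn_invFunOn ht,
        Real.coe_toNNReal _ (by positivity), dist_eq_norm, dist_eq_norm, Real.norm_eq_abs,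
        inv_mul_eq_div, le_div_iff₀ hκ, mul_comm]
      exact le_norm_sub_of_almost_linear (h s hs t ht)
    have := hL.hausdorffMeasure_image_le zero_le_one
    rw [hinj.invFunOn_image subset_rfl, hausdorffMeasure_real, ENNReal.rpow_one] at this
    calc ENNReal.ofReal (‖v‖ - ε) * volume A
        ≤ ENNReal.ofReal (‖v‖ - ε) * (ENNReal.ofReal (‖v‖ - ε)⁻¹ * μH[1] (γ '' A)) := by
          gcongr; exact this
      _ = μH[1] (γ '' A) := by
          rw [← mul_assoc, ← ENNReal.ofReal_mul hκ.le, mul_inv_cancel₀ hκ.ne', ENNReal.ofReal_one,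
            one_mul]
  have hsplit : ENNReal.ofReal (‖v‖ + ε) = ENNReal.ofReal (‖v‖ - ε) + ENNReal.ofReal (2 * ε) := by
    rw [← ENNReal.ofReal_add (sub_pos.2 hv).le (by positivity)]
    congr 1; ring
  constructor
  · refine hup.trans ?_
    rw [hsplit, add_mul]
    gcongr
    rw [← setLIntegral_const]
    refine setLIntegral_mono' hA fun t ht => ?_
    rw [← ofReal_norm]
    refine ENNReal.ofReal_le_ofReal ?_
    have := norm_sub_norm_le v (deriv γ t)
    rw [norm_sub_rev] at this
    linarith [hd t ht]
  · calc ∫⁻ t in A, ‖deriv γ t‖ₑ ≤ ∫⁻ _ in A, ENNReal.ofReal (‖v‖ + ε) := by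
          refine setLIntegral_mono' hA fun t ht => ?_
          rw [← ofReal_norm]
          refine ENNReal.ofReal_le_ofReal ?_
          have := norm_sub_norm_le (deriv γ t) v
          linarith [hd t ht]
      _ = ENNReal.ofReal (‖v‖ - ε) * volume A + ENNReal.ofReal (2 * ε) * volume A := by
          rw [setLIntegral_const, hsplit, add_mul]
      _ ≤ _ := by gcongr

/-- A fine partition into arcs on which a regular curve is almost linear and bi-Lipschitz. -/
theorem IsRegularW2Curve.exists_arcs (hγ : IsRegularW2Curve p γ) {ε : ℝ} (hε : 0 < ε) :
    ∃ (n : ℕ) (s : ℕ → ℝ) (ε' c : ℝ), Monotone s ∧ s 0 = 0 ∧ s n = 2 * Real.pi ∧ 0 < ε' ∧ ε' ≤ ε ∧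
      0 < c ∧ ∀ k < n,
      (∀ u ∈ Icc (s k) (s (k + 1)), ∀ t ∈ Icc (s k) (s (k + 1)), c * |u - t| ≤ ‖γ u - γ t‖) ∧
      ∃ v : Plane, ε' < ‖v‖ ∧ ∀ u ∈ Icc (s k) (s (k + 1)), ‖deriv γ u - v‖ ≤ ε' ∧
        ∀ t ∈ Icc (s k) (s (k + 1)), ‖γ u - γ t - (u - t) • v‖ ≤ ε' * |u - t| := by
  obtain ⟨m, M, hm, hb⟩ := hγ.exists_norm_deriv_bounds
  have hε' : 0 < min ε (m / 2) := lt_min hε (by positivity)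
  obtain ⟨δ, hδ, H⟩ := hγ.exists_almost_linear hε'
  obtain ⟨n, s, hs, h0, hn, hsδ⟩ := exists_partition hδ
  refine ⟨n, s, min ε (m / 2), m / 2, hs, h0, hn, hε', min_le_left _ _, by positivity,
    fun k hk => ?_⟩
  have ha : 0 ≤ s k := h0 ▸ hs (zero_le)
  have hb' : s (k + 1) ≤ 2 * Real.pi := hn ▸ hs hk
  have hmem : s k ∈ Icc (s k) (s (k + 1)) := ⟨le_rfl, hs k.le_succ⟩
  have H' := H _ _ ha hb' (hsδ k) (s k) hmem
  have hmv : min ε (m / 2) ≤ m / 2 := min_le_right _ _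
  refine ⟨fun u hu t ht => ?_, deriv γ (s k), ?_, H'⟩
  · refine le_trans ?_ (le_norm_sub_of_almost_linear ((H' u hu).2 t ht))
    gcongr
    linarith [(hb (s k)).1]
  · linarith [(hb (s k)).1]

theorem injOn_of_expanding {A : Set ℝ} {c : ℝ} (hc : 0 < c)
    (h : ∀ u ∈ A, ∀ t ∈ A, c * |u - t| ≤ ‖γ u - γ t‖) : InjOn γ A := by
  intro u hu t ht e
  have := h u hu t ht
  rw [e, sub_self, norm_zero] at this
  exact sub_eq_zero.1 (abs_nonpos_iff.1 (nonpos_of_mul_nonpos_right this hc))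

/-- The length measure `|γ'| dt` on the circle. -/
noncomputable def lengthMeasure (γ : ℝ → Plane) : Measure ℝ :=
  circleMeasure.withDensity (fun t => ‖deriv γ t‖ₑ)

theorem lengthMeasure_eq_restrict (γ : ℝ → Plane) :
    lengthMeasure γ =
      (volume.withDensity (fun t => ‖deriv γ t‖ₑ)).restrict (Ico 0 (2 * Real.pi)) := by
  rw [lengthMeasure, circleMeasure_eq_restrict_Ico, restrict_withDensity measurableSet_Ico]

theorem IsRegularW2Curve.measurable_enorm_deriv (hγ : IsRegularW2Curve p γ) :
    Measurable fun t => ‖deriv γ t‖ₑ := hγ.continuous_deriv.enorm.measurable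

theorem lengthMeasure_absolutelyContinuous (γ : ℝ → Plane) :
    lengthMeasure γ ≪ circleMeasure := withDensity_absolutelyContinuous _ _

theorem IsRegularW2Curve.circleMeasure_absolutelyContinuous (hγ : IsRegularW2Curve p γ) :
    circleMeasure ≪ lengthMeasure γ :=
  withDensity_absolutelyContinuous' hγ.measurable_enorm_deriv.aemeasurable
    (Eventually.of_forall fun t => by simpa using hγ.regular t)

theorem IsRegularW2Curve.measurable_encard_fiber (hγ : IsRegularW2Curve p γ) :
    Measurable fun x => ((fiber γ x).encard : ℝ≥0∞) := by
  obtain ⟨n, s, ε', c, hs, h0, hn, -, -, hc, H⟩ := hγ.exists_arcs zero_lt_one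
  have hinj : ∀ k < n, InjOn γ (Ico (s k) (s (k + 1))) := fun k hk =>
    (injOn_of_expanding hc (H k hk).1).mono Ico_subset_Icc_self
  simp only [encard_fiber_eq_sum hs h0 hn hinj]
  refine Finset.measurable_sum _ fun k hk => measurable_one.indicator ?_
  exact measurableSet_Ico.image_of_continuousOn_injOn hγ.contDiff.continuous.continuousOn
    (hinj k (Finset.mem_range.1 hk))

/-- A point has finitely many preimages under a regular closed curve. -/
theorem IsRegularW2Curve.finite_fiber (hγ : IsRegularW2Curve p γ) (x : Plane) :
    (fiber γ x).Finite := by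
  obtain ⟨n, s, ε', c, hs, h0, hn, -, -, hc, H⟩ := hγ.exists_arcs zero_lt_one
  have hinj : ∀ k < n, InjOn γ (Ico (s k) (s (k + 1))) := fun k hk =>
    (injOn_of_expanding hc (H k hk).1).mono Ico_subset_Icc_self
  rw [← encard_ne_top_iff]
  intro h
  have h1 := encard_fiber_eq_sum hs h0 hn hinj x
  rw [h, ENat.toENNReal_top] at h1
  refine (ENNReal.sum_lt_top.2 fun k _ => ?_).ne h1.symm
  exact (indicator_le_self _ _ _).trans_lt (by simp)

/-- **Area formula**: the image of the length measure of a regular closed curve is the length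
measure of the image, weighted with the number of preimages. -/
theorem IsRegularW2Curve.map_lengthMeasure (hγ : IsRegularW2Curve p γ) :
    (lengthMeasure γ).map γ = μH[1].withDensity (fun x => ((fiber γ x).encard : ℝ≥0∞)) := by
  have hcont := hγ.contDiff.continuous
  ext B hB
  -- on each arc of a fine partition the curve is injective and `ε`-close to linear, so the two
  -- measures differ there by at most `2ε` times the parameter length
  have key : ∀ ε : ℝ, 0 < ε → ∃ E : ℝ≥0∞, E ≤ ENNReal.ofReal (2 * ε * (2 * Real.pi)) ∧
      (lengthMeasure γ).map γ B ≤ μH[1].withDensity (fun x => ((fiber γ x).encard : ℝ≥0∞)) B + E ∧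
      μH[1].withDensity (fun x => ((fiber γ x).encard : ℝ≥0∞)) B
        ≤ (lengthMeasure γ).map γ B + E := by
    intro ε hε
    obtain ⟨n, s, ε', c, hs, h0, hn, hε', hle, hc, H⟩ := hγ.exists_arcs hε
    have hinj : ∀ k < n, InjOn γ (Ico (s k) (s (k + 1))) := fun k hk =>
      (injOn_of_expanding hc (H k hk).1).mono Ico_subset_Icc_self
    have hmA : ∀ k, MeasurableSet (Ico (s k) (s (k + 1)) ∩ γ ⁻¹' B) := fun k =>
      measurableSet_Ico.inter (hcont.measurable hB)
    have hL : (lengthMeasure γ).map γ B =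
        ∑ k ∈ Finset.range n, ∫⁻ t in Ico (s k) (s (k + 1)) ∩ γ ⁻¹' B, ‖deriv γ t‖ₑ := by
      rw [Measure.map_apply hcont.measurable hB, lengthMeasure_eq_restrict]
      conv_lhs => rw [← h0, ← hn]
      rw [restrict_Ico_eq_sum _ hs, Measure.finsetSum_apply]
      refine Finset.sum_congr rfl fun k _ => ?_
      rw [Measure.restrict_apply' measurableSet_Ico, inter_comm, withDensity_apply _ (hmA k)]
    have hR : μH[1].withDensity (fun x => ((fiber γ x).encard : ℝ≥0∞)) B =
        ∑ k ∈ Finset.range n, μH[1] (γ '' (Ico (s k) (s (k + 1)) ∩ γ ⁻¹' B)) := by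
      have hmi : ∀ k ∈ Finset.range n, MeasurableSet (γ '' Ico (s k) (s (k + 1))) := fun k hk =>
        measurableSet_Ico.image_of_continuousOn_injOn hcont.continuousOn
          (hinj k (Finset.mem_range.1 hk))
      rw [withDensity_apply _ hB]
      simp only [encard_fiber_eq_sum hs h0 hn hinj]
      rw [lintegral_finsetSum' _ fun k hk => (measurable_one.indicator (hmi k hk)).aemeasurable]
      refine Finset.sum_congr rfl fun k hk => ?_
      rw [lintegral_indicator_one (hmi k hk), Measure.restrict_apply (hmi k hk),
        image_inter_preimage]
    have hcomp : ∀ k ∈ Finset.range n, _ ∧ _ := fun k hk => by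
      obtain ⟨-, v, hv, hv'⟩ := H k (Finset.mem_range.1 hk)
      exact hausdorffMeasure_image_of_almost_linear (γ := γ) (hmA k) hε'.le hv
        (fun u hu => (hv' u (Ico_subset_Icc_self hu.1)).1)
        (fun u hu t ht => (hv' u (Ico_subset_Icc_self hu.1)).2 t (Ico_subset_Icc_self ht.1))
    refine ⟨∑ k ∈ Finset.range n,
      ENNReal.ofReal (2 * ε') * volume (Ico (s k) (s (k + 1)) ∩ γ ⁻¹' B), ?_, ?_, ?_⟩
    · rw [← Finset.mul_sum, mul_assoc 2 ε, mul_comm ε, ← mul_assoc,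
        mul_comm]
      calc _ ≤ ENNReal.ofReal (2 * Real.pi) * ENNReal.ofReal (2 * ε') := by
            refine mul_le_mul_left ?_ _
            calc _ ≤ ∑ k ∈ Finset.range n, volume.restrict (Ico (s k) (s (k + 1))) univ := by
                  refine Finset.sum_le_sum fun k _ => ?_
                  rw [Measure.restrict_apply_univ]
                  exact measure_mono inter_subset_left
              _ = ENNReal.ofReal (2 * Real.pi) := by
                  rw [← Measure.finsetSum_apply, ← restrict_Ico_eq_sum _ hs, h0, hn]
                  simp
        _ ≤ _ := by
            rw [← ENNReal.ofReal_mul (by positivity)]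
            apply ENNReal.ofReal_le_ofReal
            nlinarith [circle_pos]
    · rw [hL, hR, ← Finset.sum_add_distrib]
      exact Finset.sum_le_sum fun k hk => (hcomp k hk).2
    · rw [hL, hR, ← Finset.sum_add_distrib]
      exact Finset.sum_le_sum fun k hk => (hcomp k hk).1
  have key' : ∀ ε : ℝ≥0, 0 < ε → ∃ E : ℝ≥0∞, E ≤ ε ∧
      (lengthMeasure γ).map γ B ≤ μH[1].withDensity (fun x => ((fiber γ x).encard : ℝ≥0∞)) B + E ∧
      μH[1].withDensity (fun x => ((fiber γ x).encard : ℝ≥0∞)) B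
        ≤ (lengthMeasure γ).map γ B + E := by
    intro ε hε
    have hpi := Real.pi_pos
    obtain ⟨E, hE, h⟩ := key (ε / (4 * Real.pi)) (by positivity)
    refine ⟨E, hE.trans ?_, h⟩
    rw [show 2 * ((ε : ℝ) / (4 * Real.pi)) * (2 * Real.pi) = ε by field_simp; norm_num,
      ENNReal.ofReal_coe_nnreal]
  apply le_antisymm
  · refine ENNReal.le_of_forall_pos_le_add fun ε hε _ => ?_
    obtain ⟨E, hE, h, -⟩ := key' ε hε
    exact h.trans (by gcongr)
  · refine ENNReal.le_of_forall_pos_le_add fun ε hε _ => ?_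
    obtain ⟨E, hE, -, h⟩ := key' ε hε
    exact h.trans (by gcongr)

theorem IsRegularW2Curve.measurableSet_image (hγ : IsRegularW2Curve p γ) :
    MeasurableSet (γ '' Ico 0 (2 * Real.pi)) := by
  have : γ '' Ico 0 (2 * Real.pi) = {x | ((fiber γ x).encard : ℝ≥0∞) = 0}ᶜ := by
    ext x
    simp only [mem_image, mem_compl_iff, mem_ofPred_eq, ENat.toENNReal_eq_zero, encard_eq_zero]
    rw [← ne_eq, ← nonempty_iff_ne_empty]
    rfl
  rw [this]
  exact (hγ.measurable_encard_fiber (measurableSet_singleton 0)).compl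

/-- The weight of the image varifold is the image of the length measure. -/
theorem IsRegularW2Curve.weightedLength_eq (hγ : IsRegularW2Curve p γ) :
    weightedLength (γ '' Ico 0 (2 * Real.pi)) (fun x => ((fiber γ x).encard : ℝ≥0∞))
      = (lengthMeasure γ).map γ := by
  have hS := hγ.measurableSet_image
  rw [hγ.map_lengthMeasure, weightedLength, ← restrict_withDensity hS,
    Measure.restrict_eq_self_of_ae_mem]
  rw [ae_iff, show {x | x ∉ γ '' Ico 0 (2 * Real.pi)} = (γ '' Ico 0 (2 * Real.pi))ᶜ from rfl,
    withDensity_apply _ hS.compl]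
  refine (setLIntegral_congr_fun hS.compl (g := 0) fun x hx => ?_).trans (by simp)
  simp only [Pi.zero_apply, ENat.toENNReal_eq_zero, encard_eq_zero]
  exact eq_empty_of_forall_notMem fun t ht => hx ⟨t, ht.1, ht.2⟩

/-- The length measure of the image of a regular curve is absolutely continuous with respect to
the weight of its image varifold. -/
theorem IsRegularW2Curve.absolutelyContinuous_map (hγ : IsRegularW2Curve p γ) :
    (μH[1] : Measure Plane).restrict (γ '' Ico 0 (2 * Real.pi)) ≪ (lengthMeasure γ).map γ := by
  rw [← hγ.weightedLength_eq, weightedLength]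
  refine withDensity_absolutelyContinuous' hγ.measurable_encard_fiber.aemeasurable ?_
  filter_upwards [ae_restrict_mem hγ.measurableSet_image] with x hx
  obtain ⟨t, ht, rfl⟩ := hx
  simp only [ne_eq, ENat.toENNReal_eq_zero, encard_eq_zero]
  exact Nonempty.ne_empty ⟨t, ht, rfl⟩

/-- A function on the plane is measurable on the image of a regular curve if its composition with
the curve is. -/
theorem IsRegularW2Curve.aemeasurable_map {β : Type*} [MeasurableSpace β]
    (hγ : IsRegularW2Curve p γ) {F : Plane → β}
    (hF : AEMeasurable (fun t => F (γ t)) circleMeasure) :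
    AEMeasurable F ((lengthMeasure γ).map γ) := by
  have hcont := hγ.contDiff.continuous
  obtain ⟨n, s, ε', c, hs, h0, hn, -, -, hc, H⟩ := hγ.exists_arcs zero_lt_one
  have hF' : AEMeasurable (fun t => F (γ t)) (lengthMeasure γ) :=
    hF.mono_ac (lengthMeasure_absolutelyContinuous γ)
  rw [lengthMeasure_eq_restrict, ← h0, ← hn] at hF' ⊢
  rw [restrict_Ico_eq_sum _ hs, ← Measure.sum_coe_finset, Measure.map_sum hcont.aemeasurable,
    aemeasurable_sum_measure_iff]
  rintro ⟨k, hk⟩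
  have hk' := Finset.mem_range.1 hk
  set A := Ico (s k) (s (k + 1)) with hA
  have hAsub : A ⊆ Ico (s 0) (s n) := Ico_subset_Ico (hs zero_le) (hs hk')
  have hinj : InjOn γ A := (injOn_of_expanding hc (H k hk').1).mono Ico_subset_Icc_self
  have hemb := hcont.continuousOn.measurableEmbedding (measurableSet_Ico : MeasurableSet A) hinj
  have hFA := hF'.mono_measure (Measure.restrict_mono_set _ hAsub)
  rw [aemeasurable_restrict_iff_comap_subtype measurableSet_Ico] at hFA
  rw [← map_comap_subtype_coe measurableSet_Ico,
    Measure.map_map hcont.measurable measurable_subtype_coe]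
  exact hemb.aemeasurable_map_iff.2 hFA

end Area

/-! ### Locality of tangents and curvature -/

section NormalPart

/-- The part of a vector that is orthogonal to `a`, as a continuous linear map. -/
noncomputable def normalPart (a : Plane) : Plane →L[ℝ] Plane :=
  ContinuousLinearMap.id ℝ Plane - (‖a‖ ^ 2)⁻¹ • (innerSL ℝ a).smulRight a

theorem normalPart_apply (a v : Plane) :
    normalPart a v = v - (inner ℝ v a / ‖a‖ ^ 2) • a := by
  simp only [normalPart, sub_apply, ContinuousLinearMap.id_apply, smul_apply,
    ContinuousLinearMap.smulRight_apply, innerSL_apply_apply, smul_smul]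
  rw [real_inner_comm, inv_mul_eq_div]

theorem normalPart_self (a : Plane) : normalPart a a = 0 := by
  rw [normalPart_apply, real_inner_self_eq_norm_sq]
  rcases eq_or_ne a 0 with rfl | h
  · simp
  · rw [div_self (by simpa using h), one_smul, sub_self]

theorem normalPart_smul {c : ℝ} (hc : c ≠ 0) (a : Plane) : normalPart (c • a) = normalPart a := by
  ext1 v
  rw [normalPart_apply, normalPart_apply, inner_smul_right, norm_smul, mul_pow, smul_smul,
    Real.norm_eq_abs, sq_abs]
  congr 2
  rcases eq_or_ne a 0 with rfl | h
  · simp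
  · have : ‖a‖ ≠ 0 := norm_ne_zero_iff.2 h
    field_simp

theorem eq_smul_of_normalPart_eq_zero {a b : Plane} (hb : b ≠ 0) (h : normalPart a b = 0) :
    ∃ c : ℝ, c ≠ 0 ∧ b = c • a := by
  rw [normalPart_apply, sub_eq_zero] at h
  refine ⟨_, fun hc => hb ?_, h⟩
  rw [h, hc, zero_smul]

theorem curvature_eq_normalPart (γ : ℝ → Plane) (t : ℝ) :
    curvature γ t = (‖deriv γ t‖ ^ 2)⁻¹ • normalPart (deriv γ t) (weakDeriv (deriv γ) t) := by
  rw [normalPart_apply, curvature]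

end NormalPart

/-- The second order Taylor expansion at a critical point of a function that is twice differentiable
only at that point. -/
theorem tendsto_taylor_two {F : Type*} [NormedAddCommGroup F] [NormedSpace ℝ F] {q q' : ℝ → F}
    {t : ℝ} {w : F} (hq : ∀ u, HasDerivAt q (q' u) u) (h0 : q' t = 0) (hw : HasDerivAt q' w t) :
    Tendsto (fun u => ((u - t) ^ 2)⁻¹ • (q u - q t)) (𝓝[≠] t) (𝓝 ((2 : ℝ)⁻¹ • w)) := by
  rw [Metric.tendsto_nhds]
  intro ε hε
  have h1 : ∀ᶠ u in 𝓝 t, ‖q' u - (u - t) • w‖ ≤ ε / 2 * ‖u - t‖ := by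
    have := (hasDerivAt_iff_isLittleO.1 hw).def (half_pos hε)
    simpa [h0] using this
  obtain ⟨δ, hδ, H⟩ := Metric.eventually_nhds_iff_ball.1 h1
  filter_upwards [self_mem_nhdsWithin, nhdsWithin_le_nhds (Metric.ball_mem_nhds t hδ)] with u hne hu
  have hne' : 0 < |u - t| := abs_pos.2 (sub_ne_zero.2 hne)
  have hder : ∀ v ∈ uIcc t u, HasDerivWithinAt (fun v => q v - ((v - t) ^ 2 / 2) • w)
      (q' v - (v - t) • w) (uIcc t u) v := by
    intro v _
    have h2 : HasDerivAt (fun v => (v - t) ^ 2 / 2) (v - t) v := by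
      have := (((hasDerivAt_id v).sub_const t).pow 2).div_const 2
      simpa using this
    exact ((hq v).sub (h2.smul_const w)).hasDerivWithinAt
  have hle : ∀ v ∈ uIcc t u, |v - t| ≤ |u - t| := fun v hv => by
    have := abs_sub_left_of_mem_uIcc hv
    simpa [abs_sub_comm] using this
  have hb : ∀ v ∈ uIcc t u, ‖q' v - (v - t) • w‖ ≤ ε / 2 * |u - t| := by
    intro v hv
    refine (H v ?_).trans ?_
    · rw [Metric.mem_ball, Real.dist_eq] at hu ⊢
      exact (hle v hv).trans_lt hu
    · rw [Real.norm_eq_abs]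
      exact mul_le_mul_of_nonneg_left (hle v hv) (half_pos hε).le
  have := (convex_uIcc t u).norm_image_sub_le_of_norm_hasDerivWithin_le hder hb left_mem_uIcc
    right_mem_uIcc
  simp only [sub_self, ne_eq, OfNat.ofNat_ne_zero, not_false_eq_true, zero_pow, zero_div, zero_smul,
    sub_zero, Real.norm_eq_abs] at this
  rw [dist_eq_norm]
  have e : ((u - t) ^ 2)⁻¹ • (q u - q t) - (2 : ℝ)⁻¹ • w
      = ((u - t) ^ 2)⁻¹ • (q u - ((u - t) ^ 2 / 2) • w - q t) := by
    have : u - t ≠ 0 := sub_ne_zero.2 hne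
    rw [sub_right_comm, smul_sub _ (q u - q t), smul_smul]
    congr 2
    field_simp
  rw [e, norm_smul, norm_inv, norm_pow, Real.norm_eq_abs, inv_mul_lt_iff₀ (by positivity)]
  calc _ ≤ ε / 2 * |u - t| * |u - t| := this
    _ < |u - t| ^ 2 * ε := by nlinarith [mul_pos (mul_pos hne' hne') hε]

section TwoCurves

variable {α β : ℝ → Plane} {t s : ℝ} {ι : Type*} {l : Filter ι}

/-- The direction of the secants of a curve tends to the tangent direction. -/
theorem tendsto_norm_secant (hα : HasDerivAt α (deriv α t) t) (ha : deriv α t ≠ 0)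
    (P : Plane →L[ℝ] Plane) {T : ι → ℝ} (hT : Tendsto T l (𝓝[≠] t)) :
    Tendsto (fun i => ‖P (α (T i) - α t)‖ / ‖α (T i) - α t‖) l
      (𝓝 (‖P (deriv α t)‖ / ‖deriv α t‖)) := by
  have h1 := hα.tendsto_slope.comp hT
  have h2 := ((P.continuous.tendsto _).comp h1).norm.div h1.norm (norm_ne_zero_iff.2 ha)
  refine h2.congr' ?_
  filter_upwards [hT self_mem_nhdsWithin] with i hi
  have : |T i - t|⁻¹ ≠ 0 := inv_ne_zero (abs_ne_zero.2 (sub_ne_zero.2 hi))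
  simp only [Function.comp, slope_def_module, map_smul, norm_smul, norm_inv, Real.norm_eq_abs,
    Pi.div_apply]
  rw [mul_div_mul_left _ _ this]

/-- The deviation of a curve from its tangent, measured in terms of the squared length of the
secant, tends to half the curvature. -/
theorem tendsto_secant_deviation (hα : ∀ u, HasDerivAt α (deriv α u) u) (ha : deriv α t ≠ 0)
    {w : Plane} (hw : HasDerivAt (deriv α) w t) {P : Plane →L[ℝ] Plane} (hP : P (deriv α t) = 0)
    {T : ι → ℝ} (hT : Tendsto T l (𝓝[≠] t)) :
    Tendsto (fun i => (‖α (T i) - α t‖ ^ 2)⁻¹ • P (α (T i) - α t)) l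
      (𝓝 ((‖deriv α t‖ ^ 2)⁻¹ • (2 : ℝ)⁻¹ • P w)) := by
  have h1 := (((hα t).tendsto_slope.comp hT).norm.pow 2).inv₀
    (pow_ne_zero 2 (norm_ne_zero_iff.2 ha))
  have h2 := (tendsto_taylor_two (q := fun u => P (α u)) (q' := fun u => P (deriv α u))
    (fun u => P.hasFDerivAt.comp_hasDerivAt u (hα u)) hP
    (P.hasFDerivAt.comp_hasDerivAt t hw)).comp hT
  refine (h1.smul h2).congr' ?_
  filter_upwards [hT self_mem_nhdsWithin] with i hi
  have : (T i - t) ≠ 0 := sub_ne_zero.2 hi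
  simp only [Function.comp, slope_def_module, norm_smul, norm_inv, Real.norm_eq_abs, mul_pow,
    smul_smul, map_sub, mul_inv, inv_pow, inv_inv, sq_abs]
  congr 1
  field_simp

/-- Two curves with second derivatives at a common point that is a limit of further common points
have the same tangent and the same curvature vector there: both are determined by the limits of the
secants to the common points. -/
theorem normalPart_eq_of_accumulated (hα : ∀ u, HasDerivAt α (deriv α u) u)
    (hβ : ∀ u, HasDerivAt β (deriv β u) u) (ha : deriv α t ≠ 0) (hb : deriv β s ≠ 0)
    {v w : Plane} (hv : HasDerivAt (deriv α) v t) (hw : HasDerivAt (deriv β) w s)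
    (hts : α t = β s)
    (hacc : ∀ ε > 0, ∃ t' s', |t' - t| < ε ∧ |s' - s| < ε ∧ α t' = β s' ∧ α t' ≠ α t) :
    normalPart (deriv α t) (deriv β s) = 0 ∧
      (‖deriv α t‖ ^ 2)⁻¹ • normalPart (deriv α t) v
        = (‖deriv β s‖ ^ 2)⁻¹ • normalPart (deriv β s) w := by
  choose T S hT hS hTS hne using fun n : ℕ => hacc (1 / ((n : ℝ) + 1)) (by positivity)
  have hlim : ∀ {U : ℕ → ℝ} {u : ℝ}, (∀ n, |U n - u| < 1 / ((n : ℝ) + 1)) → (∀ n, U n ≠ u) →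
      Tendsto U atTop (𝓝[≠] u) := fun {U u} h h' => by
    refine tendsto_nhdsWithin_iff.2 ⟨?_, Eventually.of_forall h'⟩
    rw [tendsto_iff_dist_tendsto_zero]
    exact squeeze_zero (fun _ => dist_nonneg) (fun n => by rw [Real.dist_eq]; exact (h n).le)
      tendsto_one_div_add_atTop_nhds_zero_nat
  have hT' := hlim hT fun n h => hne n (by rw [h])
  have hS' := hlim hS fun n h => hne n (by rw [hTS, h, hts])
  have e : ∀ n, β (S n) - β s = α (T n) - α t := fun n => by rw [hTS, hts]
  have hpar : normalPart (deriv α t) (deriv β s) = 0 := by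
    have h1 := tendsto_norm_secant (hα t) ha (normalPart (deriv α t)) hT'
    have h2 := tendsto_norm_secant (hβ s) hb (normalPart (deriv α t)) hS'
    simp only [e] at h2
    have := tendsto_nhds_unique h2 h1
    rw [normalPart_self, norm_zero, zero_div, div_eq_zero_iff] at this
    exact norm_eq_zero.1 (this.resolve_right (norm_ne_zero_iff.2 hb))
  refine ⟨hpar, ?_⟩
  obtain ⟨c, hc, hbc⟩ := eq_smul_of_normalPart_eq_zero hb hpar
  have h1 := tendsto_secant_deviation hα ha hv (normalPart_self _) hT'
  have h2 := tendsto_secant_deviation hβ hb hw hpar hS'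
  simp only [e] at h2
  have := tendsto_nhds_unique h1 h2
  rw [smul_comm, smul_comm _ (2 : ℝ)⁻¹] at this
  have h3 := smul_right_injective Plane (by norm_num : (2 : ℝ)⁻¹ ≠ 0) this
  have h4 : normalPart (deriv β s) = normalPart (deriv α t) := by rw [hbc, normalPart_smul hc]
  rw [h4]
  exact h3

/-- All but countably many common points of two curves are limits of further common points. -/
theorem countable_not_accumulated (α β : ℝ → Plane) :
    {x | ∃ t s, α t = x ∧ β s = x ∧ ∃ ε > 0, ∀ t' s', |t' - t| < ε → |s' - s| < ε →
      α t' = β s' → α t' = x}.Countable := by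
  have hc : (⋃ q : (ℚ × ℚ) × ℚ × ℚ,
      {x | α '' Ioo (q.1.1 : ℝ) q.1.2 ∩ β '' Ioo (q.2.1 : ℝ) q.2.2 = {x}}).Countable :=
    countable_iUnion fun q => Subsingleton.countable fun x hx y hy =>
      singleton_injective (Eq.trans (Eq.symm hx) hy)
  refine hc.mono ?_
  rintro x ⟨t, s, rfl, hs, ε, hε, H⟩
  obtain ⟨a, ha1, ha2⟩ := exists_rat_btwn (sub_lt_self t hε)
  obtain ⟨b, hb1, hb2⟩ := exists_rat_btwn (lt_add_of_pos_right t hε)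
  obtain ⟨c, hc1, hc2⟩ := exists_rat_btwn (sub_lt_self s hε)
  obtain ⟨d, hd1, hd2⟩ := exists_rat_btwn (lt_add_of_pos_right s hε)
  refine mem_iUnion.2 ⟨((a, b), c, d), ?_⟩
  refine eq_singleton_iff_unique_mem.2 ⟨⟨⟨t, ⟨ha2, hb1⟩, rfl⟩, ⟨s, ⟨hc2, hd1⟩, hs⟩⟩, ?_⟩
  rintro y ⟨⟨t', ht', rfl⟩, s', hs', e⟩
  refine H t' s' ?_ ?_ e.symm <;> rw [abs_lt]
  · constructor <;> linarith [ht'.1, ht'.2]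
  · constructor <;> linarith [hs'.1, hs'.2]

end TwoCurves

section Regular

variable {p q : ℝ} {γ η : ℝ → Plane}

/-- Almost every point of the image of a regular curve is passed only at parameters that belong to a
given set of full measure. -/
theorem IsRegularW2Curve.ae_forall_fiber (hγ : IsRegularW2Curve p γ) {Q : ℝ → Prop}
    (hQ : ∀ᵐ t ∂circleMeasure, Q t) :
    ∀ᵐ x ∂(μH[1] : Measure Plane), ∀ t ∈ fiber γ x, Q t := by
  rw [circleMeasure_eq_restrict_Ico, ae_restrict_iff' measurableSet_Ico] at hQ
  obtain ⟨K, hK⟩ := hγ.exists_lipschitz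
  have h0 : μH[1] (γ '' {t | ¬ (t ∈ Ico 0 (2 * Real.pi) → Q t)}) = 0 := by
    refine le_antisymm ((hK.hausdorffMeasure_image_le zero_le_one _).trans ?_) zero_le
    rw [hausdorffMeasure_real, ae_iff.1 hQ, mul_zero]
  rw [ae_iff]
  refine measure_mono_null ?_ h0
  intro x hx
  simp only [mem_ofPred_eq, not_forall] at hx
  obtain ⟨t, ht, hn⟩ := hx
  exact ⟨t, fun h => hn (h ht.1), ht.2⟩

/-- At almost every common point, two regular curves of class `W^{2,p}` have the same tangent and
the same curvature vector. -/
theorem IsRegularW2Curve.ae_curvature_eq (hγ : IsRegularW2Curve p γ) (hη : IsRegularW2Curve q η) :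
    ∀ᵐ x ∂(μH[1] : Measure Plane), ∀ t ∈ fiber γ x, ∀ s ∈ fiber η x,
      normalPart (deriv γ t) (deriv η s) = 0 ∧ curvature γ t = curvature η s := by
  have := Measure.nullSingletonClass_hausdorff Plane one_pos
  have hcount := (countable_not_accumulated γ η).measure_zero (μH[1] : Measure Plane)
  filter_upwards [hγ.ae_forall_fiber hγ.ae_hasDerivAt_deriv,
    hη.ae_forall_fiber hη.ae_hasDerivAt_deriv, measure_eq_zero_iff_ae_notMem.1 hcount]
    with x h1 h2 h3 t ht s hs
  rw [curvature_eq_normalPart, curvature_eq_normalPart]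
  refine normalPart_eq_of_accumulated hγ.hasDerivAt hη.hasDerivAt (hγ.regular t) (hη.regular s)
    (h1 t ht) (h2 s hs) (ht.2.trans hs.2.symm) fun ε hε => ?_
  by_contra hcon
  push Not at hcon
  refine h3 ⟨t, s, ht.2, hs.2, ε, hε, fun t' s' h h' e => ?_⟩
  rw [hcon t' s' h h' e, ht.2]

end Regular

/-! ### Approximate tangent lines of regular curves -/

section SpanLine

open Classical in
/-- The line spanned by a nonzero vector (and an arbitrary line for the zero vector). -/
noncomputable def spanLine (v : Plane) : Line :=
  if h : v ≠ 0 then ⟨Submodule.span ℝ {v}, finrank_span_singleton h⟩ else Classical.arbitrary Line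

theorem coe_spanLine {v : Plane} (h : v ≠ 0) : (spanLine v).1 = Submodule.span ℝ {v} :=
  congrArg Subtype.val (dif_pos h)

theorem proj_spanLine {v : Plane} (h : v ≠ 0) :
    (spanLine v).proj = ContinuousLinearMap.id ℝ Plane - normalPart v := by
  ext1 w
  have e : (spanLine v).proj = (Submodule.span ℝ {v}).starProjection := by
    unfold Line.proj
    congr 1
    exact coe_spanLine h
  rw [e, Submodule.starProjection_singleton, sub_apply, ContinuousLinearMap.id_apply,
    normalPart_apply, sub_sub_cancel, real_inner_comm]
  rfl

theorem spanLine_eq_of_normalPart {v w : Plane} (hv : v ≠ 0) (hw : w ≠ 0)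
    (h : normalPart v w = 0) : spanLine v = spanLine w := by
  obtain ⟨c, hc, rfl⟩ := eq_smul_of_normalPart_eq_zero hw h
  apply Line.proj_injective
  rw [proj_spanLine hv, proj_spanLine hw, normalPart_smul hc]

theorem isInducing_proj : IsInducing Line.proj := ⟨rfl⟩

theorem continuous_normalPart {γ : ℝ → Plane} (hc : Continuous γ) (h : ∀ t, γ t ≠ 0) :
    Continuous fun t => normalPart (γ t) := by
  unfold normalPart
  have h1 : Continuous fun t => (innerSL ℝ (γ t)).smulRight (γ t) :=
    ((ContinuousLinearMap.smulRightL ℝ Plane Plane).continuous.comp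
      ((innerSL ℝ).continuous.comp hc)).clm_apply hc
  exact continuous_const.sub (((hc.norm.pow 2).inv₀ fun t =>
    pow_ne_zero 2 (norm_ne_zero_iff.2 (h t))).smul h1)

theorem continuous_spanLine {γ : ℝ → Plane} (hc : Continuous γ) (h : ∀ t, γ t ≠ 0) :
    Continuous fun t => spanLine (γ t) := by
  rw [isInducing_proj.continuous_iff]
  have : (Line.proj ∘ fun t => spanLine (γ t))
      = fun t => ContinuousLinearMap.id ℝ Plane - normalPart (γ t) :=
    funext fun t => proj_spanLine (h t)
  rw [this]
  exact continuous_const.sub (continuous_normalPart hc h)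

/-- The integral over a line with respect to length. -/
theorem setIntegral_spanLine {v : Plane} (hv : v ≠ 0) (f : Plane → ℝ) :
    ∫ y in ((spanLine v).1 : Set Plane), f y ∂μH[1] = ∫ u : ℝ, f (u • v) * ‖v‖ := by
  have hn : ‖v‖ ≠ 0 := norm_ne_zero_iff.2 hv
  have hiso : Isometry fun u : ℝ => u • (‖v‖⁻¹ • v) := by
    refine Isometry.of_dist_eq fun a b => ?_
    rw [dist_eq_norm, ← sub_smul, norm_smul, norm_smul, norm_inv, norm_norm,
      inv_mul_cancel₀ hn, mul_one, dist_eq_norm]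
  have hrange : (range fun u : ℝ => u • (‖v‖⁻¹ • v)) = ((spanLine v).1 : Set Plane) := by
    rw [coe_spanLine hv]
    ext y
    simp only [mem_range, SetLike.mem_coe, Submodule.mem_span_singleton, smul_smul]
    constructor
    · rintro ⟨u, rfl⟩
      exact ⟨_, rfl⟩
    · rintro ⟨u, rfl⟩
      exact ⟨u * ‖v‖, by rw [mul_assoc, mul_inv_cancel₀ hn, mul_one]⟩
  have hmap := hiso.map_hausdorffMeasure (d := 1) (Or.inl zero_le_one)
  rw [hrange, hausdorffMeasure_real] at hmap
  rw [← hmap, (hiso.isClosedEmbedding.measurableEmbedding).integral_map]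
  have := Measure.integral_comp_mul_right (fun u : ℝ => f (u • (‖v‖⁻¹ • v))) ‖v‖
  have e : ∀ u : ℝ, (u * ‖v‖) • (‖v‖⁻¹ • v) = u • v := fun u => by
    rw [smul_smul, mul_assoc, mul_inv_cancel₀ hn, mul_one]
  simp only [e] at this
  rw [integral_mul_const, this, abs_of_nonneg (inv_nonneg.2 (norm_nonneg v)), smul_eq_mul,
    mul_right_comm, inv_mul_cancel₀ hn, one_mul]

end SpanLine

section Blowup

variable {p : ℝ} {γ : ℝ → Plane}

theorem integral_lengthMeasure {F : Type*} [NormedAddCommGroup F] [NormedSpace ℝ F]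
    (hγ : IsRegularW2Curve p γ) (g : ℝ → F) :
    ∫ t, g t ∂(lengthMeasure γ) = ∫ t, ‖deriv γ t‖ • g t ∂circleMeasure :=
  integral_withDensity_eq_integral_smul (f := fun t => ‖deriv γ t‖₊)
    hγ.continuous_deriv.nnnorm.measurable g

/-- The blow-up of an arc at an interior point. -/
theorem IsRegularW2Curve.tendsto_blowup_arc (hγ : IsRegularW2Curve p γ) {a b c t₀ : ℝ} (hc : 0 < c)
    (hexp : ∀ u ∈ Icc a b, ∀ t ∈ Icc a b, c * |u - t| ≤ ‖γ u - γ t‖) (ht₀ : t₀ ∈ Ioo a b)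
    {f : Plane → ℝ} (hf : Continuous f) (hfs : HasCompactSupport f) :
    Tendsto (fun r : ℝ => r⁻¹ * ∫ t in Ico a b, ‖deriv γ t‖ * f (r⁻¹ • (γ t - γ t₀))) (𝓝[>] 0)
      (𝓝 (∫ u : ℝ, f (u • deriv γ t₀) * ‖deriv γ t₀‖)) := by
  obtain ⟨m, M, -, hM⟩ := hγ.exists_norm_deriv_bounds
  obtain ⟨C, hC⟩ := hf.bounded_above_of_compact_support hfs
  obtain ⟨R, hR⟩ := hfs.isCompact.isBounded.subset_closedBall (0 : Plane)
  have hC0 : 0 ≤ C := (norm_nonneg _).trans (hC 0)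
  have hM0 : 0 ≤ M := (norm_nonneg _).trans (hM 0).2
  have hcont := hγ.contDiff.continuous
  have hcont' := hγ.continuous_deriv
  set G : ℝ → ℝ → ℝ := fun r u => (Ico a b).indicator
    (fun t => ‖deriv γ t‖ * f (r⁻¹ • (γ t - γ t₀))) (t₀ + r * u) with hG
  have hresc : ∀ r : ℝ, 0 < r →
      r⁻¹ * ∫ t in Ico a b, ‖deriv γ t‖ * f (r⁻¹ • (γ t - γ t₀)) = ∫ u, G r u := by
    intro r hr
    have := Measure.integral_comp_mul_left (fun y => (Ico a b).indicator
      (fun t => ‖deriv γ t‖ * f (r⁻¹ • (γ t - γ t₀))) (t₀ + y)) r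
    rw [hG, this, integral_add_left_eq_self
      (fun y => (Ico a b).indicator (fun t => ‖deriv γ t‖ * f (r⁻¹ • (γ t - γ t₀))) y),
      integral_indicator measurableSet_Ico, abs_of_pos (by positivity), smul_eq_mul]
  have key : Tendsto (fun r : ℝ => ∫ u, G r u) (𝓝[>] 0)
      (𝓝 (∫ u : ℝ, f (u • deriv γ t₀) * ‖deriv γ t₀‖)) := by
    refine tendsto_integral_filter_of_dominated_convergence
      ((Icc (-(R / c)) (R / c)).indicator fun _ => M * C) ?_ ?_ ?_ ?_
    · refine Eventually.of_forall fun r => Measurable.aestronglyMeasurable ?_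
      refine Measurable.comp (Measurable.indicator ?_ measurableSet_Ico) (by fun_prop)
      exact (hcont'.norm.mul (hf.comp ((hcont.sub continuous_const).const_smul r⁻¹))).measurable
    · filter_upwards [self_mem_nhdsWithin] with r hr
      refine Eventually.of_forall fun u => ?_
      have hr' : 0 < r := hr
      by_cases ht : t₀ + r * u ∈ Ico a b
      · simp only [hG, indicator_of_mem ht]
        by_cases hu : u ∈ Icc (-(R / c)) (R / c)
        · rw [indicator_of_mem hu, norm_mul, norm_norm]
          exact mul_le_mul (hM _).2 (hC _) (norm_nonneg _) hM0
        · -- outside the bounded interval the rescaled arc has left the support of `f`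
          have hlt : R / c < |u| := by
            rw [← not_le, abs_le]
            exact hu
          have h1 := hexp _ (Ico_subset_Icc_self ht) _ (Ioo_subset_Icc_self ht₀)
          rw [add_sub_cancel_left, abs_mul, abs_of_pos hr'] at h1
          have h2 : R < ‖r⁻¹ • (γ (t₀ + r * u) - γ t₀)‖ := by
            rw [norm_smul, norm_inv, Real.norm_eq_abs, abs_of_pos hr', inv_mul_eq_div,
              lt_div_iff₀ hr']
            rw [div_lt_iff₀ hc] at hlt
            nlinarith
          have h3 : f (r⁻¹ • (γ (t₀ + r * u) - γ t₀)) = 0 := by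
            refine image_eq_zero_of_notMem_tsupport fun h => ?_
            have := hR h
            rw [mem_closedBall_zero_iff] at this
            linarith
          rw [h3, mul_zero, norm_zero, indicator_of_notMem hu]
      · simp only [hG, indicator_of_notMem ht, norm_zero]
        exact indicator_nonneg (fun _ _ => by positivity) _
    · exact (integrable_indicator_iff measurableSet_Icc).2 continuous_const.integrableOn_Icc
    · refine Eventually.of_forall fun u => ?_
      have hlin : Tendsto (fun r : ℝ => t₀ + r * u) (𝓝[>] 0) (𝓝 t₀) := by
        have : Continuous fun r : ℝ => t₀ + r * u := by fun_prop
        simpa using (this.tendsto 0).mono_left nhdsWithin_le_nhds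
      have hev : ∀ᶠ r in 𝓝[>] (0 : ℝ), t₀ + r * u ∈ Ico a b :=
        hlin.eventually (Ico_mem_nhds ht₀.1 ht₀.2)
      have hd : HasDerivAt (fun r : ℝ => γ (t₀ + r * u)) (u • deriv γ t₀) 0 := by
        have h1 : HasDerivAt (fun r : ℝ => t₀ + r * u) u 0 := by
          simpa using ((hasDerivAt_id (0 : ℝ)).mul_const u).const_add t₀
        have h2 := hγ.hasDerivAt (t₀ + 0 * u)
        have := h2.scomp (0 : ℝ) h1
        simpa [Function.comp_def] using this
      have hs : Tendsto (fun r : ℝ => r⁻¹ • (γ (t₀ + r * u) - γ t₀)) (𝓝[>] 0)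
          (𝓝 (u • deriv γ t₀)) := by
        have := hd.tendsto_slope_zero.mono_left 
          (nhdsWithin_mono 0 (fun r hr => ne_of_gt hr : Ioi (0 : ℝ) ⊆ {0}ᶜ))
        simpa using this
      have := ((hcont'.norm.tendsto t₀).comp hlin).mul ((hf.tendsto _).comp hs)
      rw [mul_comm]
      refine this.congr' ?_
      filter_upwards [hev] with r hr
      simp only [hG, indicator_of_mem hr, Function.comp]
  exact key.congr' (by filter_upwards [self_mem_nhdsWithin] with r hr using (hresc r hr).symm)

/-- The blow-up of an arc at a point not on the arc. -/
theorem IsRegularW2Curve.tendsto_blowup_arc_of_notMem (hγ : IsRegularW2Curve p γ) {a b : ℝ}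
    {x : Plane} (hx : x ∉ γ '' Icc a b) {f : Plane → ℝ} (hfs : HasCompactSupport f) :
    Tendsto (fun r : ℝ => r⁻¹ * ∫ t in Ico a b, ‖deriv γ t‖ * f (r⁻¹ • (γ t - x))) (𝓝[>] 0)
      (𝓝 0) := by
  obtain ⟨R, hR⟩ := hfs.isCompact.isBounded.subset_closedBall (0 : Plane)
  have hcl : IsClosed (γ '' Icc a b) := (isCompact_Icc.image hγ.contDiff.continuous).isClosed
  obtain ⟨d, hd, hball⟩ := Metric.isOpen_iff.1 hcl.isOpen_compl x hx
  have hev : ∀ᶠ r in 𝓝[>] (0 : ℝ), r * R < d := by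
    have : Continuous fun r : ℝ => r * R := by fun_prop
    have h0 : Tendsto (fun r : ℝ => r * R) (𝓝[>] 0) (𝓝 0) := by
      simpa using (this.tendsto 0).mono_left nhdsWithin_le_nhds
    exact h0.eventually_lt_const hd
  refine tendsto_const_nhds.congr' ?_
  filter_upwards [hev, self_mem_nhdsWithin] with r hr hr0
  have hr' : 0 < r := hr0
  rw [setIntegral_congr_fun (g := fun _ => (0 : ℝ)) measurableSet_Ico, integral_zero, mul_zero]
  intro t ht
  have h1 : d ≤ ‖γ t - x‖ := by
    by_contra h
    push Not at h
    exact hball (by rwa [Metric.mem_ball, dist_eq_norm]) (mem_image_of_mem _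
      (Ico_subset_Icc_self ht))
  have h3 : f (r⁻¹ • (γ t - x)) = 0 := by
    refine image_eq_zero_of_notMem_tsupport fun h => ?_
    have := hR h
    rw [mem_closedBall_zero_iff, norm_smul, norm_inv, Real.norm_eq_abs, abs_of_pos hr',
      inv_mul_le_iff₀ hr'] at this
    linarith
  simp only [h3, mul_zero]

/-- At almost every point of its image, a regular curve has as approximate tangent the common
tangent of all its branches through that point. -/
theorem IsRegularW2Curve.ae_isApproxTangent (hγ : IsRegularW2Curve p γ) :
    ∀ᵐ x ∂(μH[1] : Measure Plane), ∀ t ∈ fiber γ x,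
      IsApproxTangent (γ '' Ico 0 (2 * Real.pi)) (fun x => ((fiber γ x).encard : ℝ≥0∞)) x
        (spanLine (deriv γ t)) := by
  have := Measure.nullSingletonClass_hausdorff Plane one_pos
  have hcont := hγ.contDiff.continuous
  obtain ⟨n, s, ε', c, hs, h0, hn, -, -, hc, H⟩ := hγ.exists_arcs zero_lt_one
  have hinj : ∀ k < n, InjOn γ (Ico (s k) (s (k + 1))) := fun k hk =>
    (injOn_of_expanding hc (H k hk).1).mono Ico_subset_Icc_self
  have hcount := ((countable_range s).image γ).measure_zero (μH[1] : Measure Plane)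
  filter_upwards [hγ.ae_curvature_eq hγ, measure_eq_zero_iff_ae_notMem.1 hcount]
    with x hx hend t ht f hf hfs
  have hnode : ∀ k, x ≠ γ (s k) := fun k h => hend ⟨s k, mem_range_self k, h.symm⟩
  set I : ℝ := ∫ y in ((spanLine (deriv γ t)).1 : Set Plane), f y ∂μH[1] with hI
  have harc : ∀ k ∈ Finset.range n, Tendsto (fun r : ℝ => r⁻¹ *
      ∫ t in Ico (s k) (s (k + 1)), ‖deriv γ t‖ * f (r⁻¹ • (γ t - x))) (𝓝[>] 0)
      (𝓝 (((γ '' Ico (s k) (s (k + 1))).indicator 1 x : ℝ≥0∞).toReal * I)) := by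
    intro k hk
    have hk' := Finset.mem_range.1 hk
    by_cases hxk : x ∈ γ '' Ico (s k) (s (k + 1))
    · rw [indicator_of_mem hxk, Pi.one_apply, ENNReal.toReal_one, one_mul]
      obtain ⟨u, hu, rfl⟩ := hxk
      have hu' : u ∈ Ioo (s k) (s (k + 1)) :=
        ⟨lt_of_le_of_ne hu.1 fun h => hnode k (by rw [h]), hu.2⟩
      have hfib : u ∈ fiber γ (γ u) :=
        ⟨⟨(h0 ▸ hs zero_le : 0 ≤ s k).trans hu.1, hu.2.trans_le (hn ▸ hs hk')⟩, rfl⟩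
      rw [hI, spanLine_eq_of_normalPart (hγ.regular t) (hγ.regular u) (hx t ht u hfib).1,
        setIntegral_spanLine (hγ.regular u)]
      exact hγ.tendsto_blowup_arc hc (H k hk').1 hu' hf hfs
    · rw [indicator_of_notMem hxk, ENNReal.toReal_zero, zero_mul]
      refine hγ.tendsto_blowup_arc_of_notMem ?_ hfs
      rintro ⟨u, hu, rfl⟩
      rcases hu.2.lt_or_eq with h | h
      · exact hxk ⟨u, ⟨hu.1, h⟩, rfl⟩
      · exact hnode (k + 1) (by rw [h])
  have hsum := tendsto_finsetSum _ harc
  rw [← Finset.sum_mul, ← ENNReal.toReal_sum fun k _ =>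
    ((indicator_le_self _ _ x).trans_lt (by simp : (1 : Plane → ℝ≥0∞) x < ⊤)).ne,
    ← encard_fiber_eq_sum hs h0 hn hinj] at hsum
  refine hsum.congr fun r => ?_
  have hcf : Continuous fun t => f (r⁻¹ • (γ t - x)) :=
    hf.comp ((hcont.sub continuous_const).const_smul r⁻¹)
  have hcg : Continuous fun y => f (r⁻¹ • (y - x)) :=
    hf.comp ((continuous_id.sub continuous_const).const_smul r⁻¹)
  rw [hγ.weightedLength_eq, integral_map hcont.aemeasurable hcg.aestronglyMeasurable,
    integral_lengthMeasure hγ, circleMeasure_eq_restrict_Ico, ← h0, ← hn,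
    restrict_Ico_eq_sum _ hs, integral_finsetSum_measure, Finset.mul_sum]
  · rfl
  · intro k _
    exact ((hγ.continuous_deriv.norm.smul hcf).integrableOn_Icc).mono_set Ico_subset_Icc_self

end Blowup

section TangentField

/-- The approximate tangent line is unique where the multiplicity is positive and finite. -/
theorem IsApproxTangent.eq_spanLine {Γ : Set Plane} {θ : Plane → ℝ≥0∞} {x v : Plane} {L : Line}
    (hv : v ≠ 0) (h0 : θ x ≠ 0) (htop : θ x ≠ ⊤) (h : IsApproxTangent Γ θ x (spanLine v))
    (hL : IsApproxTangent Γ θ x L) : L = spanLine v := by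
  by_contra hne
  have hvL : v ∉ L.1 := by
    intro hmem
    refine hne (Subtype.ext ?_)
    rw [coe_spanLine hv]
    refine (Submodule.eq_of_le_of_finrank_eq ?_ ?_).symm
    · rwa [Submodule.span_singleton_le_iff_mem]
    · rw [finrank_span_singleton hv, L.2]
  -- a tent function around a point of one line that vanishes on the other
  obtain ⟨d, hd, hball⟩ := Metric.isOpen_iff.1
    (Submodule.closed_of_finiteDimensional L.1).isOpen_compl v hvL
  set f : Plane → ℝ := fun y => max 0 (d - dist y v) with hf
  have hfc : Continuous f := by fun_prop
  have hfs : HasCompactSupport f := by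
    refine HasCompactSupport.of_support_subset_isCompact (isCompact_closedBall v d) fun y hy => ?_
    rw [Metric.mem_closedBall]
    by_contra hlt
    exact hy (max_eq_left (by linarith))
  have hzero : ∫ y in (L.1 : Set Plane), f y ∂μH[1] = 0 := by
    rw [setIntegral_congr_fun (g := fun _ => (0 : ℝ))
      (Submodule.closed_of_finiteDimensional L.1).measurableSet, integral_zero]
    intro y hy
    refine max_eq_left ?_
    by_contra hlt
    exact hball (Metric.mem_ball.2 (by linarith)) hy
  have hlim := tendsto_nhds_unique (h f hfc hfs) (hL f hfc hfs)
  rw [hzero, mul_zero, mul_eq_zero, setIntegral_spanLine hv] at hlim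
  have hpos : 0 < ∫ u : ℝ, f (u • v) * ‖v‖ := by
    refine Continuous.integral_pos_of_hasCompactSupport_nonneg_nonzero (x := 1)
      (by fun_prop) ?_ (fun u => mul_nonneg (le_max_left _ _) (norm_nonneg v)) ?_
    · exact (hfs.comp_isClosedEmbedding (isClosedEmbedding_smul_left hv)).mul_right
    · simp [hf, hv, hd]
  rcases hlim with h' | h'
  · exact (ENNReal.toReal_pos h0 htop).ne' h'
  · exact hpos.ne' h'

variable {p : ℝ} {γ : ℝ → Plane}

/-- A property of almost every point of the plane with respect to length holds at almost every
parameter of a regular curve. -/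
theorem IsRegularW2Curve.ae_comp (hγ : IsRegularW2Curve p γ) {Q : Plane → Prop}
    (hQ : ∀ᵐ x ∂(μH[1] : Measure Plane), Q x) : ∀ᵐ t ∂circleMeasure, Q (γ t) := by
  have h : ∀ᵐ x ∂((lengthMeasure γ).map γ), Q x := by
    rw [hγ.map_lengthMeasure]
    exact (withDensity_absolutelyContinuous _ _).ae_le hQ
  exact hγ.circleMeasure_absolutelyContinuous.ae_le
    (ae_of_ae_map hγ.contDiff.continuous.aemeasurable h)

theorem ae_circleMeasure_mem_fiber (γ : ℝ → Plane) :
    ∀ᵐ t ∂circleMeasure, t ∈ fiber γ (γ t) := by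
  filter_upwards [ae_circleMeasure_mem_Ioo] with t ht using ⟨Ioo_subset_Ico_self ht, rfl⟩

/-- The tangent field of the image of a regular curve is given by the tangents of the curve. -/
theorem IsRegularW2Curve.tangentField_ae (hγ : IsRegularW2Curve p γ) :
    Measurable (tangentField (γ '' Ico 0 (2 * Real.pi)) fun x => ((fiber γ x).encard : ℝ≥0∞)) ∧
    ∀ᵐ t ∂circleMeasure,
      tangentField (γ '' Ico 0 (2 * Real.pi)) (fun x => ((fiber γ x).encard : ℝ≥0∞)) (γ t)
        = spanLine (deriv γ t) := by
  classical
  set Γ := γ '' Ico 0 (2 * Real.pi) with hΓ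
  set θ : Plane → ℝ≥0∞ := fun x => ((fiber γ x).encard : ℝ≥0∞) with hθ
  have hpar : ∀ᵐ x ∂(μH[1] : Measure Plane), ∀ t ∈ fiber γ x, ∀ s ∈ fiber γ x,
      spanLine (deriv γ t) = spanLine (deriv γ s) := by
    filter_upwards [hγ.ae_curvature_eq hγ] with x hx t ht s hs
    exact spanLine_eq_of_normalPart (hγ.regular t) (hγ.regular s) (hx t ht s hs).1
  -- a tangent field, up to a modification on a null set
  set T₀ : Plane → Line := fun x =>
    if h : (fiber γ x).Nonempty then spanLine (deriv γ h.some) else Classical.arbitrary Line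
    with hT₀
  have hT₀γ : ∀ᵐ t ∂circleMeasure, T₀ (γ t) = spanLine (deriv γ t) := by
    filter_upwards [hγ.ae_comp hpar, ae_circleMeasure_mem_fiber γ] with t h ht
    have hne : (fiber γ (γ t)).Nonempty := ⟨t, ht⟩
    simp only [hT₀, dif_pos hne]
    exact h _ hne.some_mem t ht
  have hm : AEMeasurable T₀ ((lengthMeasure γ).map γ) := by
    refine hγ.aemeasurable_map (AEMeasurable.congr ?_ (EventuallyEq.symm hT₀γ))
    exact (continuous_spanLine hγ.continuous_deriv hγ.regular).measurable.aemeasurable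
  have hex : ∃ T, IsTangentField Γ θ T := by
    refine ⟨hm.mk T₀, hm.measurable_mk, ?_⟩
    filter_upwards [ae_restrict_mem hγ.measurableSet_image,
      ae_restrict_of_ae hγ.ae_isApproxTangent,
      hγ.absolutelyContinuous_map.ae_le hm.ae_eq_mk] with x hx h1 h2
    have hne : (fiber γ x).Nonempty := by
      obtain ⟨t, ht, rfl⟩ := hx
      exact ⟨t, ht, rfl⟩
    rw [← h2]
    simp only [hT₀, dif_pos hne]
    exact h1 _ hne.some_mem
  have htf : tangentField Γ θ = hex.choose := by rw [tangentField, dif_pos hex]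
  rw [htf]
  refine ⟨hex.choose_spec.1, ?_⟩
  have h2 : ∀ᵐ x ∂(μH[1] : Measure Plane), x ∈ Γ → IsApproxTangent Γ θ x (hex.choose x) :=
    (ae_restrict_iff' hγ.measurableSet_image).1 hex.choose_spec.2
  filter_upwards [hγ.ae_comp h2, hγ.ae_comp hγ.ae_isApproxTangent, ae_circleMeasure_mem_fiber γ]
    with t ht1 ht2 ht
  refine IsApproxTangent.eq_spanLine (hγ.regular t) ?_ ?_ (ht2 t ht) (ht1 ⟨t, ht.1, rfl⟩)
  · simp only [ne_eq, ENat.toENNReal_eq_zero, encard_eq_zero]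
    exact Nonempty.ne_empty ⟨t, ht⟩
  · simp only [ne_eq, ENat.toENNReal_eq_top]
    exact (hγ.finite_fiber _).encard_lt_top.ne

/-- The image varifold of a regular curve is the image of the length measure under the map that
assigns to a parameter the point of the curve and its tangent. -/
theorem IsRegularW2Curve.imageVarifold_eq (hγ : IsRegularW2Curve p γ) :
    imageVarifold γ = (lengthMeasure γ).map (fun t => (γ t, spanLine (deriv γ t))) := by
  obtain ⟨hm, hae⟩ := hγ.tangentField_ae
  rw [imageVarifold, varifold, hγ.weightedLength_eq,
    Measure.map_map (measurable_id'.prodMk hm) hγ.contDiff.continuous.measurable]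
  refine Measure.map_congr ?_
  filter_upwards [(lengthMeasure_absolutelyContinuous γ).ae_le hae] with t ht
  simp only [Function.comp, ht]

theorem IsRegularW2Curve.weight_imageVarifold (hγ : IsRegularW2Curve p γ) :
    weight (imageVarifold γ) = (lengthMeasure γ).map γ := by
  rw [hγ.imageVarifold_eq, weight, Measure.map_map measurable_fst]
  · rfl
  · exact hγ.contDiff.continuous.measurable.prodMk
      (continuous_spanLine hγ.continuous_deriv hγ.regular).measurable

end TangentField

/-! ### The first variation of a regular curve -/

/-- The tangential divergence along a line is the derivative in the direction of the line. -/
theorem tangentialDiv_spanLine {v : Plane} (hv : v ≠ 0) (X : Plane → Plane) (x : Plane) :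
    tangentialDiv (spanLine v) X x = inner ℝ (fderiv ℝ X x v) v / ‖v‖ ^ 2 := by
  set A := fderiv ℝ X x with hA
  have hproj : (spanLine v).proj = (‖v‖ ^ 2)⁻¹ • InnerProductSpace.rankOne ℝ v v := by
    ext1 w
    rw [proj_spanLine hv, sub_apply, ContinuousLinearMap.id_apply, normalPart_apply,
      sub_sub_cancel, smul_apply, InnerProductSpace.rankOne_apply, smul_smul, real_inner_comm,
      inv_mul_eq_div]
  have h1 : (A ∘L InnerProductSpace.rankOne ℝ v v : Plane →L[ℝ] Plane)
      = InnerProductSpace.rankOne ℝ (A v) v := by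
    ext1 w
    simp [InnerProductSpace.rankOne_apply]
  rw [tangentialDiv, hproj, ContinuousLinearMap.toLinearMap_comp, LinearMap.trace_comp_comm',
    ← ContinuousLinearMap.toLinearMap_comp, ← hA, ContinuousLinearMap.comp_smul, h1,
    ContinuousLinearMap.toLinearMap_smul, map_smul, InnerProductSpace.trace_rankOne,
    smul_eq_mul, real_inner_comm, inv_mul_eq_div]

section FirstVariation

variable {p : ℝ} {γ : ℝ → Plane}

theorem norm_normalPart_le (a v : Plane) : ‖normalPart a v‖ ≤ 2 * ‖v‖ := by
  rw [normalPart_apply]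
  have h : ‖(inner ℝ v a / ‖a‖ ^ 2) • a‖ ≤ ‖v‖ := by
    rcases eq_or_ne a 0 with rfl | ha
    · simp
    · have ha' : 0 < ‖a‖ := norm_pos_iff.2 ha
      rw [norm_smul, norm_div, norm_pow, norm_norm, div_mul_eq_mul_div, div_le_iff₀ (by positivity)]
      nlinarith [norm_inner_le_norm (𝕜 := ℝ) v a]
  linarith [norm_sub_le v ((inner ℝ v a / ‖a‖ ^ 2) • a)]

theorem IsRegularW2Curve.aestronglyMeasurable_curvature (hγ : IsRegularW2Curve p γ) :
    AEStronglyMeasurable (curvature γ) circleMeasure := by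
  have h1 : Continuous fun t => (‖deriv γ t‖ ^ 2)⁻¹ :=
    (hγ.continuous_deriv.norm.pow 2).inv₀ fun t => pow_ne_zero 2 (norm_ne_zero_iff.2 (hγ.regular t))
  have h2 := continuous_normalPart hγ.continuous_deriv hγ.regular
  refine (h1.aestronglyMeasurable.smul
    (isBoundedBilinearMap_apply.continuous.comp_aestronglyMeasurable
      (h2.aestronglyMeasurable.prodMk hγ.integrable_weakDeriv.aestronglyMeasurable))).congr ?_
  exact Eventually.of_forall fun t => (curvature_eq_normalPart γ t).symm

theorem IsRegularW2Curve.integrable_smul_curvature (hγ : IsRegularW2Curve p γ) :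
    Integrable (fun t => ‖deriv γ t‖ • curvature γ t) circleMeasure := by
  obtain ⟨m, M, hm, hb⟩ := hγ.exists_norm_deriv_bounds
  refine Integrable.mono' (hγ.integrable_weakDeriv.norm.const_mul (2 / m))
    (hγ.continuous_deriv.norm.aestronglyMeasurable.smul hγ.aestronglyMeasurable_curvature)
    (Eventually.of_forall fun t => ?_)
  have hpos : 0 < ‖deriv γ t‖ := hm.trans_le (hb t).1
  rw [curvature_eq_normalPart, norm_smul, norm_smul, norm_norm, norm_inv, norm_pow, norm_norm,
    ← mul_assoc, show ‖deriv γ t‖ * (‖deriv γ t‖ ^ 2)⁻¹ = ‖deriv γ t‖⁻¹ by field_simp,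
    inv_mul_eq_div, div_le_iff₀ hpos]
  have h1 := norm_normalPart_le (deriv γ t) (weakDeriv (deriv γ) t)
  have h2 : 1 ≤ ‖deriv γ t‖ / m := (one_le_div₀ hm).2 (hb t).1
  calc _ ≤ 2 * ‖weakDeriv (deriv γ) t‖ * 1 := by rwa [mul_one]
    _ ≤ 2 * ‖weakDeriv (deriv γ) t‖ * (‖deriv γ t‖ / m) := by gcongr
    _ = _ := by ring

theorem IsRegularW2Curve.integrable_curvature (hγ : IsRegularW2Curve p γ) :
    Integrable (curvature γ) (lengthMeasure γ) :=
  (integrable_withDensity_iff_integrable_smul (f := fun t => ‖deriv γ t‖₊)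
    hγ.continuous_deriv.nnnorm.measurable).2 hγ.integrable_smul_curvature

/-- The derivative of the unit tangent is the curvature times the speed. -/
theorem IsRegularW2Curve.hasDerivAt_unitTangent (hγ : IsRegularW2Curve p γ) {t : ℝ}
    (ht : HasDerivAt (deriv γ) (weakDeriv (deriv γ) t) t) :
    HasDerivAt (fun t => ‖deriv γ t‖⁻¹ • deriv γ t) (‖deriv γ t‖ • curvature γ t) t := by
  have hn : ‖deriv γ t‖ ≠ 0 := norm_ne_zero_iff.2 (hγ.regular t)
  have h1 := (ht.norm_sq.sqrt (pow_ne_zero 2 hn))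
  simp only [Real.sqrt_sq (norm_nonneg _)] at h1
  have h2 := (h1.fun_inv hn).smul ht
  refine h2.congr_deriv ?_
  rw [curvature, real_inner_comm]
  match_scalars <;> field_simp

theorem norm_unit_sub_le {m : ℝ} (hm : 0 < m) {a b : Plane} (ha : m ≤ ‖a‖) (hb : m ≤ ‖b‖) :
    ‖‖a‖⁻¹ • a - ‖b‖⁻¹ • b‖ ≤ 2 / m * ‖a - b‖ := by
  have ha' : 0 < ‖a‖ := hm.trans_le ha
  have hb' : 0 < ‖b‖ := hm.trans_le hb
  have e : ‖a‖⁻¹ • a - ‖b‖⁻¹ • b = ‖a‖⁻¹ • (a - b) + (‖a‖⁻¹ - ‖b‖⁻¹) • b := by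
    rw [smul_sub, sub_smul]; abel
  have h1 : ‖(‖a‖⁻¹ - ‖b‖⁻¹) • b‖ ≤ ‖a‖⁻¹ * ‖a - b‖ := by
    rw [norm_smul, show ‖a‖⁻¹ - ‖b‖⁻¹ = ‖a‖⁻¹ * (‖b‖ - ‖a‖) * ‖b‖⁻¹ by field_simp,
      norm_mul, norm_mul, norm_inv, norm_inv, norm_norm, norm_norm, mul_assoc, inv_mul_cancel₀ hb'.ne', mul_one,
      norm_sub_rev a b]
    gcongr
    exact abs_norm_sub_norm_le b a
  rw [e]
  refine (norm_add_le _ _).trans ?_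
  rw [norm_smul, norm_inv, norm_norm]
  have h2 : ‖a‖⁻¹ ≤ m⁻¹ := inv_anti₀ hm ha
  calc _ ≤ ‖a‖⁻¹ * ‖a - b‖ + ‖a‖⁻¹ * ‖a - b‖ := by gcongr
    _ ≤ m⁻¹ * ‖a - b‖ + m⁻¹ * ‖a - b‖ := by gcongr
    _ = _ := by ring

theorem IsRegularW2Curve.absolutelyContinuous_deriv (hγ : IsRegularW2Curve p γ) :
    AbsolutelyContinuousOnInterval (deriv γ) 0 (2 * Real.pi) := by
  refine absolutelyContinuousOnInterval_of_dist_le (K := 1)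
    (absolutelyContinuousOnInterval_integral
      (intervalIntegrable_of_circle hγ.integrable_weakDeriv) left_mem_uIcc) fun s hs t ht => ?_
  rw [uIcc_of_le circle_pos.le] at hs ht
  rw [hγ.deriv_eq_add_integral s hs, hγ.deriv_eq_add_integral t ht, dist_add_left, one_mul]

/-- The first variation of the length of a regular closed curve: integration by parts for the unit
tangent, which is absolutely continuous. -/
theorem IsRegularW2Curve.firstVariation (hγ : IsRegularW2Curve p γ) {X : Plane → Plane}
    (hX : ContDiff ℝ 1 X) (hXs : HasCompactSupport X) :
    ∫ t, tangentialDiv (spanLine (deriv γ t)) X (γ t) ∂(lengthMeasure γ)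
      = - ∫ t, inner ℝ (X (γ t)) (curvature γ t) ∂(lengthMeasure γ) := by
  obtain ⟨m, M, hm, hb⟩ := hγ.exists_norm_deriv_bounds
  obtain ⟨C, hC⟩ := hX.continuous.bounded_above_of_compact_support hXs
  have hcont := hγ.contDiff.continuous
  have hcont' := hγ.continuous_deriv
  have hn : ∀ t, ‖deriv γ t‖ ≠ 0 := fun t => norm_ne_zero_iff.2 (hγ.regular t)
  set τ : ℝ → Plane := fun t => ‖deriv γ t‖⁻¹ • deriv γ t with hτ
  have hτc : Continuous τ := (hcont'.norm.inv₀ hn).smul hcont'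
  set D : ℝ → ℝ := fun t => inner ℝ (fderiv ℝ X (γ t) (deriv γ t)) (τ t) with hD
  have hDc : Continuous D :=
    (((hX.continuous_fderiv one_ne_zero).comp hcont).clm_apply hcont').inner hτc
  set E : ℝ → ℝ := fun t => inner ℝ (X (γ t)) (‖deriv γ t‖ • curvature γ t) with hE
  have hEi : Integrable E circleMeasure := by
    refine Integrable.mono' (hγ.integrable_smul_curvature.norm.const_mul C)
      ((hX.continuous.comp hcont).aestronglyMeasurable.inner
        hγ.integrable_smul_curvature.aestronglyMeasurable) (Eventually.of_forall fun t => ?_)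
    exact (norm_inner_le_norm _ _).trans (mul_le_mul_of_nonneg_right (hC _) (norm_nonneg _))
  have hDi := integrable_circleMeasure_of_continuous hDc
  have hac : AbsolutelyContinuousOnInterval (fun t => inner ℝ (X (γ t)) (τ t)) 0 (2 * Real.pi) := by
    refine absolutelyContinuousOnInterval_of_dist_le_add (K := 1) (L := C * (2 / m))
      (g := fun t => X (γ t)) (h := deriv γ)
      (ContDiffOn.absolutelyContinuousOnInterval (hX.comp hγ.contDiff).contDiffOn)
      hγ.absolutelyContinuous_deriv fun s _ t _ => ?_
    rw [dist_eq_norm, dist_eq_norm, dist_eq_norm]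
    have e : inner ℝ (X (γ s)) (τ s) - inner ℝ (X (γ t)) (τ t)
        = inner ℝ (X (γ s) - X (γ t)) (τ s) + inner ℝ (X (γ t)) (τ s - τ t) := by
      rw [inner_sub_left, inner_sub_right]; ring
    have hτ1 : ‖τ s‖ = 1 := by
      simp only [hτ]
      rw [norm_smul, norm_inv, norm_norm, inv_mul_cancel₀ (hn s)]
    rw [e]
    refine (norm_add_le _ _).trans (add_le_add ?_ ?_)
    · refine (norm_inner_le_norm _ _).trans ?_
      rw [hτ1, mul_one, one_mul]
    · refine (norm_inner_le_norm _ _).trans ?_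
      rw [mul_assoc]
      exact mul_le_mul (hC _) (norm_unit_sub_le hm (hb s).1 (hb t).1) (norm_nonneg _)
        ((norm_nonneg _).trans (hC 0))
  have hder : ∀ᵐ t, t ∈ uIcc 0 (2 * Real.pi) →
      HasDerivAt (fun t => inner ℝ (X (γ t)) (τ t)) (E t + D t) t := by
    have h1 := hγ.ae_hasDerivAt_deriv
    rw [circleMeasure, ae_restrict_iff' measurableSet_Ioc] at h1
    have h2 : ∀ᵐ t : ℝ, t ≠ 0 := by simp [ae_iff, measure_singleton]
    filter_upwards [h1, h2] with t ht hne htm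
    rw [uIcc_of_le circle_pos.le] at htm
    have hd := ht ⟨lt_of_le_of_ne htm.1 (Ne.symm hne), htm.2⟩
    have hXd : HasDerivAt (fun t => X (γ t)) (fderiv ℝ X (γ t) (deriv γ t)) t :=
      (hX.differentiable one_ne_zero (γ t)).hasFDerivAt.comp_hasDerivAt t (hγ.hasDerivAt t)
    exact hXd.inner ℝ (hγ.hasDerivAt_unitTangent hd)
  have hint := integral_eq_sub_of_absolutelyContinuous hac
    ((intervalIntegrable_of_circle hEi).add (intervalIntegrable_of_circle hDi)) hder
  have hper : inner ℝ (X (γ (2 * Real.pi))) (τ (2 * Real.pi)) = inner ℝ (X (γ 0)) (τ 0) := by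
    have h1 := hγ.memW2.1 0
    have h2 := hγ.periodic_deriv 0
    rw [zero_add] at h1 h2
    simp only [hτ, h1, h2]
  rw [hper, sub_self, ← integral_circleMeasure, integral_add hEi hDi, add_comm] at hint
  rw [integral_lengthMeasure hγ, integral_lengthMeasure hγ]
  have e1 : ∀ t, ‖deriv γ t‖ • tangentialDiv (spanLine (deriv γ t)) X (γ t) = D t := fun t => by
    rw [tangentialDiv_spanLine (hγ.regular t), hD]
    simp only [hτ, inner_smul_right, smul_eq_mul]
    have := hn t
    field_simp
  have e2 : ∀ t, ‖deriv γ t‖ • inner ℝ (X (γ t)) (curvature γ t) = E t := fun t => by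
    rw [hE]
    simp only [inner_smul_right, smul_eq_mul]
  simp only [e1, e2]
  exact eq_neg_of_add_eq_zero_left hint

end FirstVariation

/-! ### Uniqueness of generalized curvature and boundary -/

/-- A locally integrable density `u` and a finite signed measure `s` singular with respect to `μ`
that agree as distributions both vanish: on a set carrying `μ` the density `u`, off this set the
signs of the Jordan decomposition of `s`, form a single density for the measure
`μ + s⁺ + s⁻` to which the fundamental lemma of the calculus of variations applies. -/
theorem eq_zero_of_forall_integral_eq {μ : Measure Plane} {u : Plane → ℝ}
    (hu : LocallyIntegrable u μ) {s : SignedMeasure Plane} (hs : s.totalVariation ⟂ₘ μ)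
    (h : ∀ g : Plane → ℝ, ContDiff ℝ ∞ g → HasCompactSupport g →
      ∫ x, g x * u x ∂μ = ∫ x, g x ∂s.toJordanDecomposition.posPart
        - ∫ x, g x ∂s.toJordanDecomposition.negPart) :
    u =ᵐ[μ] 0 ∧ s = 0 := by
  classical
  obtain ⟨S, hS, hS0, hSc⟩ := hs
  set j := s.toJordanDecomposition with hj
  obtain ⟨P, hP, hP0, hPc⟩ := j.mutuallySingular
  have hS1 : j.posPart S = 0 := by
    rw [SignedMeasure.totalVariation, Measure.add_apply] at hS0
    exact (add_eq_zero.1 hS0).1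
  have hS2 : j.negPart S = 0 := by
    rw [SignedMeasure.totalVariation, Measure.add_apply] at hS0
    exact (add_eq_zero.1 hS0).2
  set F : Plane → ℝ := S.piecewise u (P.piecewise (fun _ => 1) fun _ => -1) with hF
  have hμ : ∀ᵐ x ∂μ, F x = u x := by
    filter_upwards [mem_ae_iff.2 hSc] with x hx
    exact piecewise_eq_of_mem _ _ _ hx
  have hpos : ∀ᵐ x ∂j.posPart, F x = -1 := by
    filter_upwards [measure_eq_zero_iff_ae_notMem.1 hS1, measure_eq_zero_iff_ae_notMem.1 hP0]
      with x hx hx'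
    rw [hF, piecewise_eq_of_notMem _ _ _ hx, piecewise_eq_of_notMem _ _ _ hx']
  have hneg : ∀ᵐ x ∂j.negPart, F x = 1 := by
    filter_upwards [measure_eq_zero_iff_ae_notMem.1 hS2, mem_ae_iff.2 hPc] with x hx hx'
    rw [hF, piecewise_eq_of_notMem _ _ _ hx, piecewise_eq_of_mem _ _ _ hx']
  have iμ : LocallyIntegrable F μ := hu.congr (hμ.mono fun x hx => hx.symm)
  have ipos : Integrable F j.posPart :=
    (integrable_const (-1 : ℝ)).congr (hpos.mono fun x hx => hx.symm)
  have ineg : Integrable F j.negPart :=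
    (integrable_const (1 : ℝ)).congr (hneg.mono fun x hx => hx.symm)
  have hFi : LocallyIntegrable F (μ + (j.posPart + j.negPart)) := fun x => by
    obtain ⟨U, hU, hUi⟩ := iμ x
    exact ⟨U, hU, hUi.add_measure (ipos.add_measure ineg).integrableOn⟩
  have hzero := ae_eq_zero_of_integral_contDiff_smul_eq_zero hFi fun g hg hgs => by
    have cg := hg.continuous
    rw [integral_add_measure (iμ.integrable_smul_left_of_hasCompactSupport cg hgs)
      ((ipos.add_measure ineg).locallyIntegrable.integrable_smul_left_of_hasCompactSupport cg hgs),
      integral_add_measure (ipos.locallyIntegrable.integrable_smul_left_of_hasCompactSupport cg hgs)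
      (ineg.locallyIntegrable.integrable_smul_left_of_hasCompactSupport cg hgs),
      integral_congr_ae (hμ.mono fun x hx => congrArg (g x • ·) hx),
      integral_congr_ae (hpos.mono fun x hx => congrArg (g x • ·) hx),
      integral_congr_ae (hneg.mono fun x hx => congrArg (g x • ·) hx)]
    simp only [smul_eq_mul, mul_neg, mul_one, integral_neg]
    rw [h g hg hgs]
    ring
  rw [ae_add_measure_iff, ae_add_measure_iff] at hzero
  obtain ⟨z1, z2, z3⟩ := hzero
  have p0 : j.posPart = 0 := by
    rw [← ae_eq_bot, ← eventually_false_iff_eq_bot]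
    filter_upwards [z2, hpos] with x hx hx'
    rw [hx] at hx'
    norm_num at hx'
  have n0 : j.negPart = 0 := by
    rw [← ae_eq_bot, ← eventually_false_iff_eq_bot]
    filter_upwards [z3, hneg] with x hx hx'
    rw [hx] at hx'
    norm_num at hx'
  refine ⟨?_, ?_⟩
  · filter_upwards [z1, hμ] with x hx hx'
    rw [← hx', hx, Pi.zero_apply]
  · rw [← SignedMeasure.toSignedMeasure_toJordanDecomposition s, ← hj,
      JordanDecomposition.toSignedMeasure]
    ext A hA
    simp [p0, n0]

/-- The component of a vector measure in the plane in a given direction. -/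
noncomputable def component (σ : VectorMeasure Plane Plane) (e : Plane) : SignedMeasure Plane :=
  σ.mapRange (innerSL ℝ e).toLinearMap.toAddMonoidHom (innerSL ℝ e).continuous

theorem component_apply (σ : VectorMeasure Plane Plane) (e : Plane) (A : Set Plane) :
    component σ e A = inner ℝ e (σ A) := rfl

theorem norm_le_sum_inner_single (v : Plane) :
    ‖v‖ ≤ ∑ i, ‖inner ℝ (EuclideanSpace.single i (1 : ℝ)) v‖ := by
  conv_lhs => rw [← (EuclideanSpace.basisFun (Fin 2) ℝ).sum_repr' v]
  refine (norm_sum_le _ _).trans (Finset.sum_le_sum fun i _ => ?_)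
  rw [norm_smul, EuclideanSpace.basisFun_apply]
  simp

/-- A vector measure with values in the plane has finite variation. -/
instance isFiniteMeasure_variation (σ : VectorMeasure Plane Plane) :
    IsFiniteMeasure σ.variation := by
  refine isFiniteMeasure_of_le
    (∑ i, (component σ (EuclideanSpace.single i (1 : ℝ))).totalVariation)
    (VectorMeasure.variation_le_of_forall_enorm_le fun A _ => ?_)
  rw [Measure.finsetSum_apply]
  refine le_trans ?_ (Finset.sum_le_sum fun i _ => SignedMeasure.enorm_le_totalVariation _ A)
  simp only [component_apply, ← ofReal_norm]
  rw [← ENNReal.ofReal_sum_of_nonneg fun i _ => norm_nonneg _]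
  exact ENNReal.ofReal_le_ofReal (norm_le_sum_inner_single _)

theorem integral_smul_const_innerSL (σ : VectorMeasure Plane Plane) {g : Plane → ℝ}
    (hg : Continuous g) (hgs : HasCompactSupport g) (e : Plane) :
    σ.integral (fun x => g x • e) (innerSL ℝ)
      = ∫ x, g x ∂(component σ e).toJordanDecomposition.posPart
        - ∫ x, g x ∂(component σ e).toJordanDecomposition.negPart := by
  have hint : ∀ (ν : Measure Plane) [IsFiniteMeasure ν], Integrable g ν := fun ν _ =>
    hg.integrable_of_hasCompactSupport hgs
  have h1 := VectorMeasure.integral_continuousLinearMap_comp (μ := σ) (B := innerSL ℝ) (f := g)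
    (C := ContinuousLinearMap.toSpanSingleton ℝ e) (hint _)
  simp only [ContinuousLinearMap.toSpanSingleton_apply] at h1
  have hfin : IsFiniteMeasure (component σ e).variation := by
    rw [← SignedMeasure.totalVariation_eq_variation]
    infer_instance
  -- both integrals depend only on the operator-valued measure `A ↦ (r ↦ r * ⟪e, σ A⟫)`
  have hT : σ.transpose (innerSL ℝ ∘L ContinuousLinearMap.toSpanSingleton ℝ e)
      = (component σ e).transpose (ContinuousLinearMap.lsmul ℝ ℝ).flip := by
    ext A hA
    change inner ℝ ((1 : ℝ) • e) (σ A) = component σ e A * 1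
    rw [one_smul, mul_one, component_apply]
  have h2 : σ.integral g (innerSL ℝ ∘L ContinuousLinearMap.toSpanSingleton ℝ e)
      = (component σ e).integral g (ContinuousLinearMap.lsmul ℝ ℝ).flip := by
    rw [VectorMeasure.integral_eq_setToFun_transpose (hint _),
      VectorMeasure.integral_eq_setToFun_transpose (hint _)]
    simp only [hT]
  rw [h1, h2]
  conv_lhs => rw [← SignedMeasure.toSignedMeasure_toJordanDecomposition (component σ e),
    JordanDecomposition.toSignedMeasure]
  have hfin' : ∀ (ν : Measure Plane) [IsFiniteMeasure ν],
      IsFiniteMeasure ν.toSignedMeasure.variation := fun ν _ => by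
    rw [← SignedMeasure.totalVariation_eq_variation]
    infer_instance
  have := hfin' (component σ e).toJordanDecomposition.posPart
  have := hfin' (component σ e).toJordanDecomposition.negPart
  rw [VectorMeasure.integral_sub_vectorMeasure (hint _) (hint _),
    VectorMeasure.integral_toSignedMeasure, VectorMeasure.integral_toSignedMeasure]

theorem mutuallySingular_component {μ : Measure Plane} {σ : VectorMeasure Plane Plane}
    (hσ : VectorMeasure.MutuallySingular σ μ.toENNRealVectorMeasure) (e : Plane) :
    (component σ e).totalVariation ⟂ₘ μ := by
  obtain ⟨S, hS, h1, h2⟩ := hσ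
  have h : VectorMeasure.MutuallySingular (component σ e) μ.toENNRealVectorMeasure :=
    ⟨S, hS, fun A hA => by rw [component_apply, h1 A hA, inner_zero_right], h2⟩
  rw [SignedMeasure.mutuallySingular_ennreal_iff] at h
  rwa [VectorMeasure.ennrealToMeasure_toENNRealVectorMeasure] at h

/-- A locally integrable vector field and a vector measure singular with respect to `μ` that agree
as distributions both vanish. -/
theorem eq_zero_of_forall_integral_inner_eq {μ : Measure Plane} {w : Plane → Plane}
    (hw : LocallyIntegrable w μ) {σ : VectorMeasure Plane Plane}
    (hσ : VectorMeasure.MutuallySingular σ μ.toENNRealVectorMeasure)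
    (h : ∀ X : Plane → Plane, ContDiff ℝ 1 X → HasCompactSupport X →
      ∫ x, inner ℝ (X x) (w x) ∂μ = σ.integral X (innerSL ℝ)) :
    w =ᵐ[μ] 0 ∧ σ = 0 := by
  have key : ∀ i : Fin 2, (fun x => inner ℝ (EuclideanSpace.single i (1 : ℝ)) (w x)) =ᵐ[μ] 0
      ∧ component σ (EuclideanSpace.single i (1 : ℝ)) = 0 := fun i => by
    refine eq_zero_of_forall_integral_eq (fun x => ?_) (mutuallySingular_component hσ _)
      fun g hg hgs => ?_
    · obtain ⟨U, hU, hUi⟩ := hw x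
      exact ⟨U, hU, hUi.const_inner _⟩
    · rw [← integral_smul_const_innerSL σ hg.continuous hgs,
        ← h (fun x => g x • EuclideanSpace.single i (1 : ℝ))
          ((hg.of_le (by simp)).smul contDiff_const) hgs.smul_right]
      simp only [inner_smul_left, RCLike.conj_to_real]
  have hv : ∀ v : Plane, (∀ i : Fin 2, inner ℝ (EuclideanSpace.single i (1 : ℝ)) v = 0) → v = 0 :=
    fun v hv => by
      rw [← norm_le_zero_iff]
      exact (norm_le_sum_inner_single v).trans_eq
        (Finset.sum_eq_zero fun i _ => by rw [hv, norm_zero])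
  refine ⟨?_, ?_⟩
  · filter_upwards [ae_all_iff.2 fun i => (key i).1] with x hx
    exact hv _ hx
  · ext1 A hA
    refine hv _ fun i => ?_
    rw [← component_apply, (key i).2, FunLike.coe_zero, Pi.zero_apply]

/-- The generalized curvature and the generalized boundary of a varifold are unique. -/
theorem HasGeneralizedCurvature.unique {V : Measure Grass} {k k' : Plane → Plane}
    {σ : VectorMeasure Plane Plane} (h : HasGeneralizedCurvature V k σ)
    (h' : HasGeneralizedCurvature V k' 0) : k =ᵐ[weight V] k' ∧ σ = 0 := by
  have hint : ∀ {X : Plane → Plane} {f : Plane → Plane}, ContDiff ℝ 1 X → HasCompactSupport X →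
      LocallyIntegrable f (weight V) →
        Integrable (fun x => inner ℝ (X x) (f x)) (weight V) := fun {X f} hX hXs hf => by
    obtain ⟨C, hC⟩ := hX.continuous.bounded_above_of_compact_support hXs
    refine (integrableOn_iff_integrable_of_support_subset (s := tsupport X) fun x hx => ?_).1 ?_
    · refine subset_tsupport X fun hx0 => hx ?_
      simp only [hx0, inner_zero_left]
    · have hf' := hf.integrableOn_isCompact hXs
      refine Integrable.mono' (hf'.norm.const_mul C)
        (hX.continuous.aestronglyMeasurable.inner hf'.aestronglyMeasurable)
        (Eventually.of_forall fun x => ?_)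
      exact (norm_inner_le_norm _ _).trans (mul_le_mul_of_nonneg_right (hC x) (norm_nonneg _))
  obtain ⟨h1, h2⟩ := eq_zero_of_forall_integral_inner_eq
    (h.locallyIntegrable.sub h'.locallyIntegrable) h.mutuallySingular fun X hX hXs => by
      have e := (h.firstVariation X hX hXs).symm.trans (h'.firstVariation X hX hXs)
      rw [VectorMeasure.integral_zero_vectorMeasure] at e
      simp only [Pi.sub_apply, inner_sub_right]
      rw [integral_sub (hint hX hXs h.locallyIntegrable) (hint hX hXs h'.locallyIntegrable)]
      linarith
  refine ⟨h1.mono fun x hx => ?_, h2⟩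
  simpa [sub_eq_zero] using hx

/-! ### Varifolds that are finite sums of closed curves -/

theorem measurable_tangentField (Γ : Set Plane) (θ : Plane → ℝ≥0∞) :
    Measurable (tangentField Γ θ) := by
  rw [tangentField]
  split_ifs with h
  · exact h.choose_spec.1
  · exact measurable_const

theorem weight_varifold (Γ : Set Plane) (θ : Plane → ℝ≥0∞) :
    weight (varifold Γ θ) = weightedLength Γ θ := by
  rw [weight, varifold, Measure.map_map measurable_fst
    (measurable_id'.prodMk (measurable_tangentField Γ θ))]
  exact Measure.map_id

theorem IsIntegerRectifiable.weight_eq {V : Measure Grass} {Γ : Set Plane} {θ : Plane → ℕ}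
    (hV : IsIntegerRectifiable V Γ θ) : weight V = weightedLength Γ fun x => (θ x : ℝ≥0∞) := by
  rw [hV.eq_varifold, weight_varifold]

theorem IsIntegerRectifiable.aemeasurable_coe {V : Measure Grass} {Γ : Set Plane} {θ : Plane → ℕ}
    (hV : IsIntegerRectifiable V Γ θ) :
    AEMeasurable (fun x => (θ x : ℝ≥0∞)) (μH[1].restrict Γ) :=
  (measurable_from_top (f := fun n : ℕ => (n : ℝ≥0∞))).comp_aemeasurable hV.aemeasurable

theorem IsIntegerRectifiable.restrict_absolutelyContinuous {V : Measure Grass} {Γ : Set Plane}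
    {θ : Plane → ℕ} (hV : IsIntegerRectifiable V Γ θ) : μH[1].restrict Γ ≪ weight V := by
  rw [hV.weight_eq]
  refine withDensity_absolutelyContinuous' hV.aemeasurable_coe ?_
  filter_upwards [hV.one_le] with x hx
  exact Nat.cast_ne_zero.2 (by omega)

section SumOfCurves

variable {p : ℝ} {N : ℕ} {γ : Fin N → ℝ → Plane}

theorem weight_sum_imageVarifold (hγ : ∀ i, IsRegularW2Curve p (γ i)) :
    weight (∑ i, imageVarifold (γ i)) = ∑ i, (lengthMeasure (γ i)).map (γ i) := by
  rw [weight, Measure.map_finset_sum measurable_fst.aemeasurable]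
  exact Finset.sum_congr rfl fun i _ => (hγ i).weight_imageVarifold

theorem sum_map_lengthMeasure (hγ : ∀ i, IsRegularW2Curve p (γ i)) :
    ∑ i, (lengthMeasure (γ i)).map (γ i)
      = μH[1].withDensity fun x => ∑ i, ((fiber (γ i) x).encard : ℝ≥0∞) := by
  ext s hs
  rw [withDensity_apply _ hs, lintegral_finsetSum _ fun i _ => (hγ i).measurable_encard_fiber,
    Measure.finsetSum_apply]
  refine Finset.sum_congr rfl fun i _ => ?_
  rw [(hγ i).map_lengthMeasure, withDensity_apply _ hs]

/-- The multiplicity of a sum of curves counts the parameters lying over a point. -/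
theorem IsIntegerRectifiable.ae_multiplicity_eq {V : Measure Grass} {Γ : Set Plane} {θ : Plane → ℕ}
    (hV : IsIntegerRectifiable V Γ θ) (hγ : ∀ i, IsRegularW2Curve p (γ i))
    (hVγ : V = ∑ i, imageVarifold (γ i)) :
    ∀ᵐ x ∂μH[1].restrict Γ, θ x = ∑ i, (fiber (γ i) x).ncard := by
  set Θ : Plane → ℝ≥0∞ := fun x => ∑ i, ((fiber (γ i) x).encard : ℝ≥0∞) with hΘ
  have hΘm : Measurable Θ := Finset.measurable_sum _ fun i _ => (hγ i).measurable_encard_fiber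
  have hw : (μH[1].restrict Γ).withDensity (fun x => (θ x : ℝ≥0∞)) = μH[1].withDensity Θ := by
    rw [← sum_map_lengthMeasure hγ, ← weight_sum_imageVarifold hγ, ← hVγ, hV.weight_eq,
      weightedLength]
  obtain ⟨Γ', -, hΓ', hae⟩ := hV.nullMeasurable.exists_measurable_superset_ae_eq
  have hr : μH[1].restrict Γ' = μH[1].restrict Γ := Measure.restrict_congr_set hae
  have hw' : (μH[1].restrict Γ).withDensity (fun x => (θ x : ℝ≥0∞))
      = (μH[1].restrict Γ).withDensity Θ := by
    rw [← hr, ← restrict_withDensity hΓ' Θ, ← hw, ← hr, restrict_withDensity hΓ',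
      Measure.restrict_restrict hΓ', inter_self]
  have hfin : ∫⁻ x, (θ x : ℝ≥0∞) ∂μH[1].restrict Γ ≠ ⊤ := by
    rw [← setLIntegral_univ, ← withDensity_apply _ MeasurableSet.univ, ← weightedLength,
      ← hV.weight_eq, weight, Measure.map_apply measurable_fst MeasurableSet.univ]
    have := hV.finite
    exact measure_ne_top _ _
  filter_upwards [(withDensity_eq_iff hV.aemeasurable_coe hΘm.aemeasurable hfin).1 hw'] with x hx
  have h : ∀ i, ((fiber (γ i) x).encard : ℝ≥0∞) = ((fiber (γ i) x).ncard : ℕ) := fun i => by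
    rw [← ((hγ i).finite_fiber x).cast_ncard_eq, ENat.toENNReal_coe]
  simp only [hΘ, h] at hx
  exact_mod_cast hx

/-- A property that holds almost everywhere for the weight of a sum of curves holds along each of
the curves. -/
theorem ae_comp_of_ae_weight {V : Measure Grass} (hγ : ∀ i, IsRegularW2Curve p (γ i))
    (hVγ : V = ∑ i, imageVarifold (γ i)) {Q : Plane → Prop} (hQ : ∀ᵐ x ∂weight V, Q x) (i : Fin N) :
    ∀ᵐ t ∂circleMeasure, Q (γ i t) := by
  rw [hVγ, weight_sum_imageVarifold hγ, ← Measure.sum_fintype, Measure.ae_sum_iff] at hQ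
  exact (hγ i).circleMeasure_absolutelyContinuous.ae_le
    (ae_of_ae_map (hγ i).contDiff.continuous.measurable.aemeasurable (hQ i))

/-- Along each of the curves the averaged curvature is the curvature of that curve: all curves
through a point have the same curvature there, so that the average is over equal terms. -/
theorem IsIntegerRectifiable.ae_averagedCurvature_eq {V : Measure Grass} {Γ : Set Plane}
    {θ : Plane → ℕ} (hV : IsIntegerRectifiable V Γ θ) (hγ : ∀ i, IsRegularW2Curve p (γ i))
    (hVγ : V = ∑ i, imageVarifold (γ i)) (i : Fin N) :
    ∀ᵐ t ∂circleMeasure, averagedCurvature θ γ (γ i t) = curvature (γ i) t := by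
  have hac : weight V ≪ μH[1].restrict Γ := by
    rw [hV.weight_eq]
    exact withDensity_absolutelyContinuous _ _
  have h1 := ae_comp_of_ae_weight hγ hVγ
    (hac.ae_le ((hV.ae_multiplicity_eq hγ hVγ).and hV.one_le)) i
  have h2 := (hγ i).ae_comp (ae_all_iff.2 fun j => (hγ i).ae_curvature_eq (hγ j))
  filter_upwards [h1, h2, ae_circleMeasure_mem_fiber (γ i)] with t ⟨hθ, hθ1⟩ hk ht
  have hsum : ∀ j, ∑ᶠ s ∈ fiber (γ j) (γ i t), curvature (γ j) s
      = ((fiber (γ j) (γ i t)).ncard : ℝ) • curvature (γ i) t := fun j => by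
    rw [finsum_mem_congr rfl fun s hs => ((hk j t ht s hs).2).symm,
      finsum_mem_eq_finite_toFinset_sum _ ((hγ j).finite_fiber _), Finset.sum_const,
      ncard_eq_toFinset_card _ ((hγ j).finite_fiber _), Nat.cast_smul_eq_nsmul]
  rw [averagedCurvature, Finset.sum_congr rfl fun j _ => hsum j, ← Finset.sum_smul, smul_smul,
    ← Nat.cast_sum, ← hθ, inv_mul_cancel₀ (Nat.cast_ne_zero.2 (by omega)), one_smul]

theorem IsIntegerRectifiable.aemeasurable_averagedCurvature {V : Measure Grass} {Γ : Set Plane}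
    {θ : Plane → ℕ} (hV : IsIntegerRectifiable V Γ θ) (hγ : ∀ i, IsRegularW2Curve p (γ i))
    (hVγ : V = ∑ i, imageVarifold (γ i)) (i : Fin N) :
    AEMeasurable (averagedCurvature θ γ) ((lengthMeasure (γ i)).map (γ i)) :=
  (hγ i).aemeasurable_map ((hγ i).aestronglyMeasurable_curvature.aemeasurable.congr
    ((hV.ae_averagedCurvature_eq hγ hVγ i).mono fun _ ht => ht.symm))

theorem IsIntegerRectifiable.integrable_averagedCurvature {V : Measure Grass} {Γ : Set Plane}
    {θ : Plane → ℕ} (hV : IsIntegerRectifiable V Γ θ) (hγ : ∀ i, IsRegularW2Curve p (γ i))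
    (hVγ : V = ∑ i, imageVarifold (γ i)) (i : Fin N) :
    Integrable (averagedCurvature θ γ) ((lengthMeasure (γ i)).map (γ i)) := by
  rw [integrable_map_measure (hV.aemeasurable_averagedCurvature hγ hVγ i).aestronglyMeasurable
    (hγ i).contDiff.continuous.measurable.aemeasurable]
  exact (hγ i).integrable_curvature.congr ((lengthMeasure_absolutelyContinuous (γ i)).ae_le
    ((hV.ae_averagedCurvature_eq hγ hVγ i).mono fun _ ht => ht.symm))

theorem continuous_tangentialDiv {X : Plane → Plane} (hX : ContDiff ℝ 1 X) :
    Continuous fun z : Grass => tangentialDiv z.2 X z.1 := by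
  have h1 : Continuous fun z : Grass => z.2.proj ∘L fderiv ℝ X z.1 :=
    (isInducing_proj.continuous.comp continuous_snd).clm_comp
      ((hX.continuous_fderiv one_ne_zero).comp continuous_fst)
  let L : (Plane →L[ℝ] Plane) →ₗ[ℝ] ℝ :=
    { toFun := fun A => LinearMap.trace ℝ Plane (A : Plane →ₗ[ℝ] Plane)
      map_add' := fun A B => by rw [ContinuousLinearMap.toLinearMap_add, map_add]
      map_smul' := fun c A => by rw [ContinuousLinearMap.toLinearMap_smul, map_smul]; rfl }
  exact L.continuous_of_finiteDimensional.comp h1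

theorem IsRegularW2Curve.integrable_tangentialDiv {γ : ℝ → Plane} (hγ : IsRegularW2Curve p γ)
    {X : Plane → Plane} (hX : ContDiff ℝ 1 X) :
    Integrable (fun t => tangentialDiv (spanLine (deriv γ t)) X (γ t)) (lengthMeasure γ) := by
  have hz : Continuous fun t => ((γ t, spanLine (deriv γ t)) : Grass) :=
    hγ.contDiff.continuous.prodMk (continuous_spanLine hγ.continuous_deriv hγ.regular)
  have hc : Continuous ((fun z : Grass => tangentialDiv z.2 X z.1) ∘
      fun t => ((γ t, spanLine (deriv γ t)) : Grass)) :=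
    Continuous.comp (continuous_tangentialDiv hX) hz
  rw [Function.comp_def] at hc
  have hi : Integrable (fun t => ‖deriv γ t‖₊ • tangentialDiv (spanLine (deriv γ t)) X (γ t))
      circleMeasure :=
    integrable_circleMeasure_of_continuous (hγ.continuous_deriv.nnnorm.smul hc)
  exact (integrable_withDensity_iff_integrable_smul (f := fun t => ‖deriv γ t‖₊)
    hγ.continuous_deriv.nnnorm.measurable).2 hi

/-- A sum of regular closed curves has no generalized boundary, and its generalized curvature is
the averaged curvature of the curves. -/
theorem IsIntegerRectifiable.hasGeneralizedCurvature {V : Measure Grass} {Γ : Set Plane}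
    {θ : Plane → ℕ} (hV : IsIntegerRectifiable V Γ θ) (hγ : ∀ i, IsRegularW2Curve p (γ i))
    (hVγ : V = ∑ i, imageVarifold (γ i)) :
    HasGeneralizedCurvature V (averagedCurvature θ γ) 0 := by
  have hwt : weight V = ∑ i, (lengthMeasure (γ i)).map (γ i) := by
    rw [hVγ, weight_sum_imageVarifold hγ]
  have hcm : ∀ i, AEMeasurable (γ i) (lengthMeasure (γ i)) := fun i =>
    (hγ i).contDiff.continuous.measurable.aemeasurable
  refine ⟨?_, VectorMeasure.MutuallySingular.zero_left, fun X hX hXs => ?_⟩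
  · rw [hwt]
    exact (integrable_finsetSum_measure.2 fun i _ =>
      hV.integrable_averagedCurvature hγ hVγ i).locallyIntegrable
  obtain ⟨C, hC⟩ := hX.continuous.bounded_above_of_compact_support hXs
  have hmeas : ∀ i, AEMeasurable (fun t => (γ i t, spanLine (deriv (γ i) t)))
      (lengthMeasure (γ i)) := fun i =>
    ((hγ i).contDiff.continuous.measurable.prodMk
      (continuous_spanLine (hγ i).continuous_deriv (hγ i).regular).measurable).aemeasurable
  have hdivm : ∀ ν : Measure Grass, AEStronglyMeasurable (fun z => tangentialDiv z.2 X z.1) ν :=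
    fun ν => (continuous_tangentialDiv hX).aestronglyMeasurable
  have hinner : ∀ i, Integrable (fun x => inner ℝ (X x) (averagedCurvature θ γ x))
      ((lengthMeasure (γ i)).map (γ i)) := fun i => by
    have hi := hV.integrable_averagedCurvature hγ hVγ i
    refine Integrable.mono' (hi.norm.const_mul C)
      (hX.continuous.aestronglyMeasurable.inner hi.aestronglyMeasurable)
      (Eventually.of_forall fun x => ?_)
    exact (norm_inner_le_norm _ _).trans (mul_le_mul_of_nonneg_right (hC x) (norm_nonneg _))
  rw [VectorMeasure.integral_zero_vectorMeasure, add_zero, hwt,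
    integral_finsetSum_measure fun i _ => hinner i, ← Finset.sum_neg_distrib, hVγ,
    integral_finsetSum_measure fun i _ => ?_]
  · refine Finset.sum_congr rfl fun i _ => ?_
    rw [(hγ i).imageVarifold_eq, integral_map (hmeas i) (hdivm _),
      integral_map (hcm i) (hinner i).aestronglyMeasurable, (hγ i).firstVariation hX hXs]
    congr 1
    refine integral_congr_ae ((lengthMeasure_absolutelyContinuous (γ i)).ae_le ?_)
    filter_upwards [hV.ae_averagedCurvature_eq hγ hVγ i] with t ht
    rw [ht]
  · rw [(hγ i).imageVarifold_eq, integrable_map_measure (hdivm _) (hmeas i)]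
    exact (hγ i).integrable_tangentialDiv hX

/-- The energy of a sum of regular closed curves is the sum of their energies. -/
theorem IsIntegerRectifiable.varifoldEnergy_eq {V : Measure Grass} {Γ : Set Plane}
    {θ : Plane → ℕ} (hV : IsIntegerRectifiable V Γ θ) (hγ : ∀ i, IsRegularW2Curve p (γ i))
    (hVγ : V = ∑ i, imageVarifold (γ i)) :
    varifoldEnergy p V = ∑ i, curveEnergy p (γ i) := by
  have hk := hV.hasGeneralizedCurvature hγ hVγ
  have hex : ∃ k σ, HasGeneralizedCurvature V k σ := ⟨_, _, hk⟩
  obtain ⟨σ, hσ⟩ := hex.choose_spec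
  rw [varifoldEnergy, dif_pos hex,
    lintegral_congr_ae ((hσ.unique hk).1.mono fun x hx => congrArg (fun v => ‖v‖ₑ ^ p) hx)]
  rw [hVγ, weight_sum_imageVarifold hγ, lintegral_finsetSum_measure]
  refine Finset.sum_congr rfl fun i _ => ?_
  have hm := ((hV.aemeasurable_averagedCurvature hγ hVγ i).enorm.pow_const p)
  have hkm : AEMeasurable (fun t => ‖curvature (γ i) t‖ₑ ^ p) circleMeasure :=
    (hγ i).aestronglyMeasurable_curvature.enorm.pow_const p
  rw [lintegral_map' hm (hγ i).contDiff.continuous.measurable.aemeasurable,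
    lintegral_congr_ae ((lengthMeasure_absolutelyContinuous (γ i)).ae_le
      ((hV.ae_averagedCurvature_eq hγ hVγ i).mono fun t ht => congrArg (fun v => ‖v‖ₑ ^ p) ht)),
    lengthMeasure, lintegral_withDensity_eq_lintegral_mul₀
      (hγ i).measurable_enorm_deriv.aemeasurable hkm, curveEnergy]
  exact lintegral_congr fun t => mul_comm _ _

end SumOfCurves

end ElasticVarifold

theorem lemma2p5 (p : ℝ) (hp : 1 < p)
    (V : MeasureTheory.Measure ElasticVarifold.Grass) (Γ : Set ElasticVarifold.Plane)
    (θ : ElasticVarifold.Plane → ℕ) (hV : ElasticVarifold.IsIntegerRectifiable V Γ θ)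
    (N : ℕ) (γ : Fin N → ℝ → ElasticVarifold.Plane)
    (hγ : ∀ i, ElasticVarifold.IsRegularW2Curve p (γ i))
    (hVγ : V = ∑ i, ElasticVarifold.imageVarifold (γ i))
    (hF : ElasticVarifold.varifoldTotalEnergy p V < ⊤) :
    -- `V` has the stated generalized curvature and zero generalized boundary,
    ElasticVarifold.HasGeneralizedCurvature V (ElasticVarifold.averagedCurvature θ γ) 0 ∧
    -- these are the only ones,
    (∀ (k : ElasticVarifold.Plane → ElasticVarifold.Plane)
        (σ : MeasureTheory.VectorMeasure ElasticVarifold.Plane ElasticVarifold.Plane),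
      ElasticVarifold.HasGeneralizedCurvature V k σ →
        (∀ᵐ x ∂((μH[1] : MeasureTheory.Measure ElasticVarifold.Plane).restrict Γ),
          k x = ElasticVarifold.averagedCurvature θ γ x) ∧ σ = 0) ∧
    -- the energy is the sum of the energies of the curves,
    ElasticVarifold.varifoldEnergy p V = ∑ i, ElasticVarifold.curveEnergy p (γ i) ∧
    -- and this sum is the same for every family of curves that defines `V`.
    (∀ (M : ℕ) (η : Fin M → ℝ → ElasticVarifold.Plane),
      (∀ j, ElasticVarifold.IsRegularW2Curve p (η j)) →
      V = ∑ j, ElasticVarifold.imageVarifold (η j) →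
        ∑ j, ElasticVarifold.curveEnergy p (η j)
          = ∑ i, ElasticVarifold.curveEnergy p (γ i)) := by
  have hk := hV.hasGeneralizedCurvature hγ hVγ
  have hE := hV.varifoldEnergy_eq hγ hVγ
  refine ⟨hk, fun k σ h => ⟨?_, (h.unique hk).2⟩, hE, fun M η hη hVη => ?_⟩
  · exact hV.restrict_absolutelyContinuous.ae_le (h.unique hk).1
  · rw [← hV.varifoldEnergy_eq hη hVη, hE]
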